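/- Let $n\ge 1$, let $\Omega\subset\mathbb R^n$ be open, and let $h\in\mathbb R$. For $S\subset\mathbb R^n$ open let $|S|$ be its Lebesgue measure and let $|\partial S|$ be the $(n-1)$-dimensional Hausdorff measure (normalized to be surface area) of its topological boundary. The Cheeger constant of $\Omega$ is $$h_\Omega=\inf_S \frac{|\partial S|}{|S|}\in[0,\infty],$$ where $S$ runs over the nonempty open sets for which there is an open set $U$ with Lipschitz boundary and $S\subset U\subset\Omega$, and for which $|S|$ and $|\partial S|$ are not both infinite. (So every open $S\subset\Omega$ with smooth or Lipschitz boundary is admitted, and, if $\Omega$ itself has Lipschitz boundary, every open $S\subset\Omega$ is. A set $U$ has Lipschitz boundary if near each of its boundary points it is, in suitable Cartesian coordinates, the region above the graph of a Lipschitz function.) (a) If $V:\Omega\to\mathbb R^n$ is a smooth vector field with $|V|\le 1$ and $\operatorname{div}V\ge h$ pointwise in $\Omega$, then $h_\Omega\ge h$. (b) Let $V\in L^\infty(\Omega,\mathbb R^n)$ be such that either the distributional divergence $\operatorname{div}V$ belongs to $L^2(\Omega)$ (class $\mathcal X_{\operatorname{div}}$), or $V$ has bounded variation, that is, all distributional derivatives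 $\partial V_i/\partial x_j$ on $\Omega$ are finite signed measures (class $\mathcal X_{BV}$). If $|V|\le 1$ almost everywhere in $\Omega$ and $\operatorname{div}V\ge h$ in the sense of distributions, that is, $-\int_\Omega V\cdot\nabla\varphi\ge h\int_\Omega\varphi$ for all $\varphi\in C_c^\infty(\Omega)$ with $\varphi\ge 0$, then $h_\Omega\ge h$. -/

import Mathlib

open MeasureTheory TopologicalSpace
open scoped ENNReal NNReal Distributions

noncomputable section

namespace CheegerField

/-- Euclidean space `ℝⁿ`. -/
abbrev Eucl (n : ℕ) : Type := EuclideanSpace ℝ (Fin n)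

/-- The `i`-th standard unit vector of `ℝⁿ`. -/
def unitVec {n : ℕ} (i : Fin n) : Eucl n := EuclideanSpace.single i (1 : ℝ)

/-- The open set `U` has Lipschitz boundary: near every boundary point there are an axis (a unit
vector `e`) and a Lipschitz function `γ` such that `U` is the region above the graph of `γ` over
the hyperplane orthogonal to `e`. Here `y - ⟪e, y⟫ e` is the orthogonal projection of `y` to this
hyperplane and `⟪e, y⟫` is the height of `y`. -/
def HasLipschitzBoundary {n : ℕ} (U : Set (Eucl n)) : Prop :=
  ∀ x ∈ frontier U, ∃ e : Eucl n, ‖e‖ = 1 ∧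
    ∃ (K : ℝ≥0) (γ : Eucl n → ℝ), LipschitzWith K γ ∧
      ∃ r : ℝ, 0 < r ∧ ∀ y ∈ Metric.ball x r,
        (y ∈ U ↔ γ (y - inner ℝ e y • e) < inner ℝ e y)

/-- `|∂S|`: the `(n-1)`-dimensional Hausdorff measure of the topological boundary, normalized so
that it is the usual surface area. -/
def boundaryMeasure {n : ℕ} (S : Set (Eucl n)) : ℝ≥0∞ :=
  Measure.euclideanHausdorffMeasure (n - 1) (frontier S)

/-- The test sets in the definition of the Cheeger constant of `Ω`: nonempty open sets `S ⊆ Ω` such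
that `S ⊆ U ⊆ Ω` for some open `U` with Lipschitz boundary, and such that the quotient
`|∂S| / |S|` is not of the meaningless form `∞ / ∞`. One may take `U = S` if `S` has Lipschitz
boundary, and `U = Ω` if `Ω` has Lipschitz boundary. -/
structure IsTestSet {n : ℕ} (Ω S : Set (Eucl n)) : Prop where
  isOpen : IsOpen S
  nonempty : S.Nonempty
  exists_lipschitz : ∃ U : Set (Eucl n), IsOpen U ∧ HasLipschitzBoundary U ∧ S ⊆ U ∧ U ⊆ Ω
  quotient_defined : volume S ≠ ⊤ ∨ boundaryMeasure S ≠ ⊤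

/-- The Cheeger constant `h_Ω = inf_S |∂S| / |S|`, in `[0, ∞]`. -/
def cheegerConstant {n : ℕ} (Ω : Set (Eucl n)) : ℝ≥0∞ :=
  ⨅ (S : Set (Eucl n)) (_ : IsTestSet Ω S), boundaryMeasure S / volume S

/-- The classical divergence `∑ i, ∂V_i / ∂x_i` at a point. -/
def divergence {n : ℕ} (V : Eucl n → Eucl n) (x : Eucl n) : ℝ :=
  ∑ i : Fin n, (fderiv ℝ V x (unitVec i)) i

/-- The distributional derivative `∂f / ∂x_j` on `Ω`, applied to a test function:
`φ ↦ - ∫_Ω f ∂φ/∂x_j`. -/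
def distribPartial {n : ℕ} (Ω : Opens (Eucl n)) (f : Eucl n → ℝ) (j : Fin n)
    (φ : 𝓓(Ω, ℝ)) : ℝ :=
  -∫ x in (Ω : Set (Eucl n)), f x * fderiv ℝ φ x (unitVec j)

/-- The distributional divergence of `V` on `Ω`, applied to a test function:
`φ ↦ - ∫_Ω ∑ i, V_i ∂φ/∂x_i`. -/
def distribDiv {n : ℕ} (Ω : Opens (Eucl n)) (V : Eucl n → Eucl n) (φ : 𝓓(Ω, ℝ)) : ℝ :=
  -∫ x in (Ω : Set (Eucl n)), ∑ i : Fin n, V x i * fderiv ℝ φ x (unitVec i)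

/-- `div V ≥ h` on `Ω` in the sense of distributions. -/
def DistribDivGE {n : ℕ} (Ω : Opens (Eucl n)) (V : Eucl n → Eucl n) (h : ℝ) : Prop :=
  ∀ φ : 𝓓(Ω, ℝ), (∀ x, 0 ≤ φ x) →
    h * ∫ x in (Ω : Set (Eucl n)), φ x ≤ distribDiv Ω V φ

/-- The class `X_div(Ω)`: fields in `L^∞(Ω, ℝⁿ)` whose distributional divergence is in `L²(Ω)`. -/
structure MemXDiv {n : ℕ} (Ω : Opens (Eucl n)) (V : Eucl n → Eucl n) : Prop where
  memLp : MemLp V ⊤ (volume.restrict (Ω : Set (Eucl n)))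
  div_mem : ∃ g : Eucl n → ℝ, MemLp g 2 (volume.restrict (Ω : Set (Eucl n))) ∧
    ∀ φ : 𝓓(Ω, ℝ), distribDiv Ω V φ = ∫ x in (Ω : Set (Eucl n)), g x * φ x

/-- The class `X_BV(Ω)`: fields in `L^∞(Ω, ℝⁿ)` all of whose distributional first derivatives
`∂V_i / ∂x_j` are signed measures on `Ω`. The integral against a signed measure is written by its
Jordan decomposition; as test functions vanish off `Ω`, only the part of the measure on `Ω`
matters. -/
structure MemXBV {n : ℕ} (Ω : Opens (Eucl n)) (V : Eucl n → Eucl n) : Prop where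
  memLp : MemLp V ⊤ (volume.restrict (Ω : Set (Eucl n)))
  deriv_measure : ∀ i j : Fin n, ∃ μ : SignedMeasure (Eucl n), ∀ φ : 𝓓(Ω, ℝ),
    distribPartial Ω (fun x => V x i) j φ =
      ∫ x, φ x ∂μ.toJordanDecomposition.posPart - ∫ x, φ x ∂μ.toJordanDecomposition.negPart

end CheegerField

end

/-!
The classical argument is that `h |S| ≤ ∫_S div V ≤ |∂S|` for every admissible set `S`, by the
divergence theorem and `‖V‖ ≤ 1`. Two points need care: `∂S` is only a topological boundary of
finite Hausdorff measure, and `V` is only a bounded measurable field, which need not be defined on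
`∂S` where this touches `∂Ω`.

For the first point, let `e` be a unit vector. On almost every line parallel to `e` the boundary
of `S` has finitely many points, so that the fundamental theorem of calculus applies to the
section of `S`. The number of boundary points, integrated over all lines, is at most the Hausdorff
measure, since the orthogonal projection along `e` is 1-Lipschitz
(`exists_measurable_fiber_sum_le`). Hence `|∫_S ∂φ/∂e| ≤ ∫_{∂S} |φ|`
(`enorm_setIntegral_fderiv_le`). As the constant is one in every direction, freezing the direction
of a `C¹` field `X` on small pieces gives `∫_S div X ≤ ∫_{∂S} ‖X‖` with the sharp constant
(`setIntegral_divergence_le`). No rectifiability and no structure theorem for sets of finite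
perimeter is used.

For the second point, `S` lies in a set `U ⊆ Ω` with Lipschitz boundary. Near each point, shifting
by `t` in the direction of the graph moves the closure of `U` into `U` with a margin proportional
to `t` (`exists_inward_shift`), so shifted mollifications of `V` are defined and smooth up to the
closure of `S`, with norm at most `1` and divergence at least `h`. As `t → 0` this gives
`h ∫_S χ + ∫_S ∇χ · V ≤ ∫_{∂S} χ` for localized cutoffs `χ ≥ 0`. The inequality is linear in `χ`,
so that a partition of unity extends it to all compactly supported `χ`
(`fluxInequality_of_hasCompactSupport`).

Finally, testing with integrable weights that tend to `1` and satisfy `‖∇χ‖ ≤ δ χ` with `δ → 0`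
gives `h |S| ≤ |∂S|` also if `|S| = ∞` (`ofReal_mul_volume_le`). Smooth fields reduce to the
distributional case (`distribDivGE_of_contDiffOn`).
-/

namespace CheegerField

open Set Filter Metric
open scoped Topology ContDiff Manifold Convolution

/-! ### Boundary points on lines -/

theorem mem_frontier_iff_of_inter_eq {X : Type*} [TopologicalSpace X] {s t u : Set X}
    (hu : IsOpen u) (h : s ∩ u = t ∩ u) {x : X} (hx : x ∈ u) :
    x ∈ frontier s ↔ x ∈ frontier t := by
  have h1 := frontier_inter_open_inter (s := s) hu
  rw [h, frontier_inter_open_inter hu] at h1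
  have := Set.ext_iff.1 h1 x
  simp only [mem_inter_iff, hx, and_true] at this
  exact this.symm

theorem subset_or_disjoint_of_disjoint_frontier {X : Type*} [TopologicalSpace X]
    {s t : Set X} (hs : IsPreconnected s) (h : Disjoint s (frontier t)) : s ⊆ t ∨ Disjoint s t := by
  have hcover : s ⊆ interior t ∪ (closure t)ᶜ := by
    intro x hx
    by_contra hcon
    simp only [mem_union, mem_compl_iff, not_or, not_not] at hcon
    exact h.le_bot ⟨hx, hcon.2, hcon.1⟩
  rcases hs.subset_or_subset isOpen_interior isClosed_closure.isOpen_compl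
    (disjoint_compl_right.mono_left interior_subset_closure) hcover with h' | h'
  · exact Or.inl (h'.trans interior_subset)
  · exact Or.inr ((disjoint_compl_left.mono_left h').mono_right subset_closure)

/-- One-dimensional case: a measurable set of reals with finite topological boundary is, up to
finitely many points, a finite union of intervals, and each boundary point contributes its value
at most once, even if it is a common endpoint of two of the intervals. -/
theorem abs_setIntegral_deriv_le_sum {ψ : ℝ → ℝ} (hψ : ContDiff ℝ 1 ψ) (hc : HasCompactSupport ψ)
    (F : Finset ℝ) : ∀ T : Set ℝ, MeasurableSet T → frontier T ⊆ F →
      |∫ t in T, deriv ψ t| ≤ ∑ t ∈ F, |ψ t| := by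
  have hint : Integrable (deriv ψ) :=
    (hψ.continuous_deriv le_rfl).integrable_of_hasCompactSupport hc.deriv
  induction F using Finset.induction_on_max with
  | empty =>
    intro T _ hF
    have hF' : frontier T = ∅ := by simpa [subset_empty_iff] using hF
    rcases isClopen_iff.1 (isClopen_iff_frontier_eq_empty.2 hF') with rfl | rfl
    · simp
    · have h1 := hc.integral_Iic_deriv_eq hψ 0
      have h2 := hc.integral_Ioi_deriv_eq hψ 0
      have h3 := intervalIntegral.integral_Iic_add_Ioi (b := (0 : ℝ)) hint.integrableOn
        hint.integrableOn
      rw [h1, h2] at h3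
      simp [← h3]
  | insert b F hb ih =>
    intro T hT hF
    have hbF : b ∉ F := fun h => lt_irrefl _ (hb b h)
    obtain ⟨c, hcb, hc'⟩ : ∃ c < b, ∀ x ∈ F, x ≤ c := by
      rcases F.eq_empty_or_nonempty with rfl | hne
      · exact ⟨b - 1, by linarith, by simp⟩
      · exact ⟨F.max' hne, hb _ (F.max'_mem hne), fun x hx => F.le_max' x hx⟩
    have hr : Ioi b ⊆ T ∨ Disjoint (Ioi b) T := by
      refine subset_or_disjoint_of_disjoint_frontier isPreconnected_Ioi ?_
      rw [disjoint_left]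
      intro x hx hx'
      rcases Finset.mem_insert.1 (hF hx') with rfl | h
      · exact lt_irrefl _ (mem_Ioi.1 hx)
      · exact absurd (hb x h) (not_lt.2 (le_of_lt hx))
    have hl : Ioo c b ⊆ T ∨ Disjoint (Ioo c b) T := by
      refine subset_or_disjoint_of_disjoint_frontier isPreconnected_Ioo ?_
      rw [disjoint_left]
      intro x hx hx'
      rcases Finset.mem_insert.1 (hF hx') with rfl | h
      · exact lt_irrefl _ hx.2
      · exact absurd (hc' x h) (not_le.2 hx.1)
    have hIci : ∫ t in Ici b, deriv ψ t = -ψ b := by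
      rw [integral_Ici_eq_integral_Ioi, hc.integral_Ioi_deriv_eq hψ]
    have hsplit : ∀ T' : Set ℝ, MeasurableSet T' →
        ∫ t in T', deriv ψ t = (∫ t in T' ∩ Iio b, deriv ψ t) + ∫ t in T' ∩ Ici b, deriv ψ t := by
      intro T' _
      rw [← compl_Iio, ← sdiff_eq, integral_inter_add_sdiff measurableSet_Iio hint.integrableOn]
    have hTr : (∫ t in T ∩ Ici b, deriv ψ t) = 0 ∨ (∫ t in T ∩ Ici b, deriv ψ t) = -ψ b := by
      have hae : (T ∩ Ici b : Set ℝ) =ᵐ[volume] (T ∩ Ioi b : Set ℝ) :=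
        (ae_eq_refl _).inter Ioi_ae_eq_Ici.symm
      rw [setIntegral_congr_set hae]
      rcases hr with h | h
      · right
        rw [inter_eq_right.2 h, hc.integral_Ioi_deriv_eq hψ]
      · left
        rw [h.symm.inter_eq]
        simp
    rw [Finset.sum_insert hbF]
    -- Remove the largest boundary point `b`: on `[b, ∞)`, continue `T` by what it is just below
    -- `b`. Before and after, the integral over `[b, ∞)` is one of `0, -ψ b`.
    obtain ⟨T', hT', hF', hI, hTr'⟩ : ∃ T' : Set ℝ, MeasurableSet T' ∧ frontier T' ⊆ F ∧
        T' ∩ Iio b = T ∩ Iio b ∧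
        ((∫ t in T' ∩ Ici b, deriv ψ t) = 0 ∨ (∫ t in T' ∩ Ici b, deriv ψ t) = -ψ b) := by
      have key : ∀ T' : Set ℝ, T' ∩ Iio b = T ∩ Iio b →
          (T' ∩ Ioi c = ∅ ∩ Ioi c ∨ T' ∩ Ioi c = univ ∩ Ioi c) → frontier T' ⊆ F := by
        intro T' h1 h2 x hx
        rcases lt_or_ge x b with hxb | hxb
        · have := hF ((mem_frontier_iff_of_inter_eq isOpen_Iio h1 hxb).1 hx)
          exact (Finset.mem_insert.1 this).resolve_left hxb.ne
        · have hxc : x ∈ Ioi c := hcb.trans_le hxb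
          rcases h2 with h2 | h2
          · simpa using (mem_frontier_iff_of_inter_eq isOpen_Ioi h2 hxc).1 hx
          · simpa using (mem_frontier_iff_of_inter_eq isOpen_Ioi h2 hxc).1 hx
      rcases hl with hl | hl
      · have h1 : (T ∪ Ici b) ∩ Iio b = T ∩ Iio b := by
          ext x; simp only [mem_inter_iff, mem_union, mem_Ici, mem_Iio]; grind
        refine ⟨T ∪ Ici b, hT.union measurableSet_Ici, key _ h1 (Or.inr ?_), h1, Or.inr ?_⟩
        · ext x
          simp only [mem_inter_iff, mem_union, mem_Ici, mem_Ioi, mem_univ, true_and,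
            and_iff_right_iff_imp]
          intro hx
          rcases lt_or_ge x b with hxb | hxb
          · exact Or.inl (hl ⟨hx, hxb⟩)
          · exact Or.inr hxb
        · rw [inter_eq_right.2 subset_union_right, hIci]
      · have h1 : (T ∩ Iio b) ∩ Iio b = T ∩ Iio b := by
          rw [inter_assoc, inter_self]
        refine ⟨T ∩ Iio b, hT.inter measurableSet_Iio, key _ h1 (Or.inl ?_), h1, Or.inl ?_⟩
        · rw [empty_inter, eq_empty_iff_forall_notMem]
          rintro x ⟨⟨hxT, hxb⟩, hxc⟩
          exact hl.le_bot ⟨⟨hxc, hxb⟩, hxT⟩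
        · have : T ∩ Iio b ∩ Ici b = ∅ := by
            rw [inter_assoc, Iio_inter_Ici, Ico_self, inter_empty]
          rw [this]; simp
    have h1 := ih T' hT' hF'
    rw [hsplit T' hT', hI] at h1
    rw [hsplit T hT]
    rcases hTr with h | h <;> rcases hTr' with h' | h' <;> rw [h] <;> rw [h'] at h1 <;>
      (have := abs_le.1 h1; rw [abs_le]; constructor <;>
        linarith [le_abs_self (ψ b), neg_abs_le (ψ b)])

/-! ### An Eilenberg inequality -/

/-- An Eilenberg inequality with weight `g`: if `p` does not increase measure, then the sum of `g`
over the fibers of `p` in `A` integrates to at most `∫_A g`. The function `G` dominates all finite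
partial sums over the fibers and takes the place of the fiber sum, whose measurability is never
needed. It is the lower limit, along partitions of the domain into cells of mesh tending to zero,
of `∑ (inf of g over the cell) · 1_{p(cell)}`, and its integral is controlled by Fatou's lemma. -/
theorem exists_measurable_fiber_sum_le {X Y : Type*} [MetricSpace X] [MeasurableSpace X]
    [BorelSpace X] [SecondCountableTopology X] [MeasurableSpace Y] (μ : Measure X) (ν : Measure Y)
    (p : X → Y) (hp : ∀ B : Set X, ν (p '' B) ≤ μ B) {A : Set X} (hA : MeasurableSet A)
    (g : X → ℝ≥0∞) (hg : Continuous g) :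
    ∃ G : Y → ℝ≥0∞, Measurable G ∧ ∫⁻ y, G y ∂ν ≤ ∫⁻ x in A, g x ∂μ ∧
      ∀ (y : Y) (s : Finset X), (∀ x ∈ s, x ∈ A ∧ p x = y) → ∑ x ∈ s, g x ≤ G y := by
  rcases isEmpty_or_nonempty X with hX | hX
  · refine ⟨0, measurable_zero, by simp, fun y s _ => ?_⟩
    rw [Finset.eq_empty_of_isEmpty s]; simp
  let r : ℕ → ℝ := fun m => 1 / ((m : ℝ) + 1)
  have hr0 : ∀ m, 0 < r m := fun m => Nat.one_div_pos_of_nat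
  have hr : Tendsto r atTop (𝓝 0) := tendsto_one_div_add_atTop_nhds_zero_nat
  let Q : ℕ → ℕ → Set X := fun m => disjointed fun k => ball (denseSeq X k) (r m)
  have hQm : ∀ m k, MeasurableSet (Q m k) := fun m k =>
    MeasurableSet.disjointed (fun _ => measurableSet_ball) k
  have hQd : ∀ m k x x', x ∈ Q m k → x' ∈ Q m k → dist x' x < 2 * r m := by
    intro m k x x' hx hx'
    have h1 : dist x (denseSeq X k) < r m :=
      disjointed_subset (fun k => ball (denseSeq X k) (r m)) k hx
    have h2 : dist x' (denseSeq X k) < r m :=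
      disjointed_subset (fun k => ball (denseSeq X k) (r m)) k hx'
    linarith [dist_triangle_right x' x (denseSeq X k)]
  have hQc : ∀ m x, ∃ k, x ∈ Q m k := by
    intro m x
    have : x ∈ ⋃ k, Q m k := by
      rw [iUnion_disjointed]
      obtain ⟨k, hk⟩ := (denseRange_denseSeq X).exists_dist_lt x (hr0 m)
      exact mem_iUnion.2 ⟨k, hk⟩
    exact mem_iUnion.1 this
  have hQdisj : ∀ m, Pairwise (Function.onFun Disjoint (Q m)) := fun m => disjoint_disjointed _
  let a : ℕ → ℕ → ℝ≥0∞ := fun m k => ⨅ x ∈ A ∩ Q m k, g x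
  -- measurable hulls, since images of measurable sets need not be measurable
  let F : ℕ → Y → ℝ≥0∞ := fun m y =>
    ∑' k, (toMeasurable ν (p '' (A ∩ Q m k))).indicator (fun _ => a m k) y
  have hFm : ∀ m, Measurable (F m) := fun m =>
    Measurable.tsum fun k => measurable_const.indicator (measurableSet_toMeasurable _ _)
  have hFint : ∀ m, ∫⁻ y, F m y ∂ν ≤ ∫⁻ x in A, g x ∂μ := by
    intro m
    calc ∫⁻ y, F m y ∂ν = ∑' k, a m k * ν (p '' (A ∩ Q m k)) := by
          rw [lintegral_tsum fun k =>
            (measurable_const.indicator (measurableSet_toMeasurable _ _)).aemeasurable]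
          refine tsum_congr fun k => ?_
          rw [lintegral_indicator_const (measurableSet_toMeasurable _ _), measure_toMeasurable]
      _ ≤ ∑' k, ∫⁻ x in A ∩ Q m k, g x ∂μ := by
          refine ENNReal.tsum_le_tsum fun k => ?_
          calc a m k * ν (p '' (A ∩ Q m k)) ≤ a m k * μ (A ∩ Q m k) := by gcongr; exact hp _
            _ = ∫⁻ x in A ∩ Q m k, a m k ∂μ := by rw [setLIntegral_const]
            _ ≤ _ := setLIntegral_mono' (hA.inter (hQm m k)) fun x hx => iInf₂_le x hx
      _ = ∫⁻ x in A, g x ∂μ := by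
          rw [← lintegral_iUnion (fun k => hA.inter (hQm m k))
            (fun i j hij => (hQdisj m hij).mono inter_subset_right inter_subset_right),
            ← inter_iUnion]
          congr 2
          exact inter_eq_left.2 fun x _ => mem_iUnion.2 (hQc m x)
  refine ⟨fun y => liminf (fun m => F m y) atTop, .liminf hFm, ?_, ?_⟩
  · refine (lintegral_liminf_le hFm).trans ?_
    exact (liminf_le_liminf (Eventually.of_forall hFint)).trans (by simp)
  · intro y s hs
    let b : ℕ → X → ℝ≥0∞ := fun m x => ⨅ x' ∈ ball x (2 * r m), g x'
    have hb : ∀ x, Tendsto (fun m => b m x) atTop (𝓝 (g x)) := by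
      intro x
      refine tendsto_order.2 ⟨fun c hc => ?_, fun c hc => ?_⟩
      · obtain ⟨c', hcc', hc'⟩ := exists_between hc
        obtain ⟨ε, hε, hball⟩ := Metric.eventually_nhds_iff_ball.1
          ((hg.tendsto x).eventually (lt_mem_nhds hc'))
        have : ∀ᶠ m in atTop, 2 * r m < ε := by
          have h2 := hr.const_mul 2
          rw [mul_zero] at h2
          exact h2.eventually (gt_mem_nhds hε)
        filter_upwards [this] with m hm
        refine hcc'.trans_le (le_iInf₂ fun x' hx' => ?_)
        exact (hball x' (ball_subset_ball hm.le hx')).le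
      · exact Eventually.of_forall fun m =>
          (iInf₂_le x (mem_ball_self (by linarith [hr0 m]))).trans_lt hc
    have hsum : Tendsto (fun m => ∑ x ∈ s, b m x) atTop (𝓝 (∑ x ∈ s, g x)) :=
      tendsto_finsetSum _ fun x _ => hb x
    rw [← hsum.liminf_eq]
    refine liminf_le_liminf ?_
    -- once the mesh is finer than the separation of `s`, its points lie in distinct cells
    have hsep : ∀ᶠ m in atTop, ∀ x ∈ s, ∀ x' ∈ s, x ≠ x' → 2 * r m < dist x' x := by
      simp only [Filter.eventually_all_finset, Filter.eventually_imp_distrib_left]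
      intro x _ x' _ hne
      have h2 := hr.const_mul 2
      rw [mul_zero] at h2
      exact h2.eventually (gt_mem_nhds (dist_pos.2 hne.symm))
    filter_upwards [hsep] with m hm
    choose κ hκ using hQc m
    have hinj : Set.InjOn κ s := by
      intro x hx x' hx' hk
      by_contra hne
      exact lt_asymm (hm x hx x' hx' hne) (hQd m (κ x) x x' (hκ x) (hk ▸ hκ x'))
    calc ∑ x ∈ s, b m x
        ≤ ∑ x ∈ s, (toMeasurable ν (p '' (A ∩ Q m (κ x)))).indicator (fun _ => a m (κ x)) y := by
          refine Finset.sum_le_sum fun x hx => ?_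
          have hy : y ∈ toMeasurable ν (p '' (A ∩ Q m (κ x))) :=
            subset_toMeasurable _ _ ⟨x, ⟨(hs x hx).1, hκ x⟩, (hs x hx).2⟩
          rw [indicator_of_mem hy]
          exact le_iInf₂ fun x' hx' => iInf₂_le x' (hQd m _ x x' (hκ x) hx'.2)
      _ = ∑ k ∈ s.image κ, (toMeasurable ν (p '' (A ∩ Q m k))).indicator (fun _ => a m k) y := by
          rw [Finset.sum_image hinj]
      _ ≤ F m y := ENNReal.sum_le_tsum _

/-! ### The derivative of an indicator function in a fixed direction -/

section Direction

variable {E : Type*} [NormedAddCommGroup E] [InnerProductSpace ℝ E] [FiniteDimensional ℝ E]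
  [MeasurableSpace E] [BorelSpace E]

theorem measurePreserving_smul_add_orthogonal {e : E} (he : ‖e‖ = 1) :
    MeasurePreserving (fun q : ℝ × ((ℝ ∙ e)ᗮ : Submodule ℝ E) => q.1 • e + (q.2 : E)) := by
  let L : WithLp 2 (ℝ × ((ℝ ∙ e)ᗮ : Submodule ℝ E)) ≃ₗᵢ[ℝ] E :=
    (LinearIsometryEquiv.withLpProdCongr 2 (LinearIsometryEquiv.toSpanUnitSingleton e he)
      (LinearIsometryEquiv.refl ℝ ((ℝ ∙ e)ᗮ : Submodule ℝ E))).trans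
      (Submodule.orthogonalDecomposition (ℝ ∙ e)).symm
  have h := L.measurePreserving.comp
    (WithLp.volume_preserving_toLp ℝ ((ℝ ∙ e)ᗮ : Submodule ℝ E))
  convert! h using 1

theorem volume_orthogonalProjection_image_le {e : E} (he : ‖e‖ = 1) (B : Set E) :
    volume ((ℝ ∙ e)ᗮ.orthogonalProjectionOnto '' B) ≤
      Measure.euclideanHausdorffMeasure (Module.finrank ℝ E - 1) B := by
  have hne : e ≠ 0 := by rintro rfl; simp at he
  have hd : Module.finrank ℝ ((ℝ ∙ e)ᗮ : Submodule ℝ E) = Module.finrank ℝ E - 1 := by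
    have h1 := Submodule.finrank_add_finrank_orthogonal (ℝ ∙ e)
    rw [finrank_span_singleton hne] at h1
    omega
  rw [← InnerProductSpace.euclideanHausdorffMeasure_eq_volume, hd,
    Measure.euclideanHausdorffMeasure_def, Measure.euclideanHausdorffMeasure_def,
    Measure.smul_apply, Measure.smul_apply]
  have := ((ℝ ∙ e)ᗮ.lipschitzWith_orthogonalProjectionOnto).hausdorffMeasure_image_le
    (Nat.cast_nonneg (Module.finrank ℝ E - 1)) B
  simp only [ENNReal.coe_one, ENNReal.one_rpow, one_mul] at this
  gcongr

/-- For a unit vector `e`, the derivative of the indicator function of `S` in direction `e` is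
bounded, with constant one, by the Hausdorff measure on the topological boundary. By Fubini along
the lines parallel to `e` this is the one-dimensional case on almost every line, followed by the
Eilenberg inequality for the orthogonal projection along `e`. -/
theorem enorm_setIntegral_fderiv_le {S : Set E} (hS : MeasurableSet S)
    (hfin : Measure.euclideanHausdorffMeasure (Module.finrank ℝ E - 1) (frontier S) ≠ ⊤)
    {e : E} (he : ‖e‖ = 1) {φ : E → ℝ} (hφ : ContDiff ℝ 1 φ) (hc : HasCompactSupport φ) :
    ‖∫ x in S, fderiv ℝ φ x e‖ₑ ≤ ∫⁻ x in frontier S, ‖φ x‖ₑ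
      ∂(Measure.euclideanHausdorffMeasure (Module.finrank ℝ E - 1)) := by
  set μ : Measure E := Measure.euclideanHausdorffMeasure (Module.finrank ℝ E - 1)
  set P : Submodule ℝ E := (ℝ ∙ e)ᗮ
  have hpe : P.orthogonalProjectionOnto e = 0 :=
    Submodule.orthogonalProjectionOnto_orthogonalComplement_singleton_eq_zero e
  have hp : ∀ (s : ℝ) (y : P), P.orthogonalProjectionOnto (s • e + (y : E)) = y := by
    intro s y
    rw [map_add, map_smul, hpe]
    simp
  obtain ⟨G, hGm, hG, hGs⟩ := exists_measurable_fiber_sum_le μ volume P.orthogonalProjectionOnto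
    (volume_orthogonalProjection_image_le he) isClosed_frontier.measurableSet
    (fun x => ‖φ x‖ₑ) hφ.continuous.enorm (A := frontier S)
  -- the same with weight one: almost every line meets the boundary in finitely many points
  obtain ⟨N, hNm, hN, hNs⟩ := exists_measurable_fiber_sum_le μ volume P.orthogonalProjectionOnto
    (volume_orthogonalProjection_image_le he) isClosed_frontier.measurableSet
    (fun _ => 1) continuous_const (A := frontier S)
  have hNfin : ∀ᵐ y, N y < ⊤ := by
    refine ae_lt_top hNm (ne_top_of_le_ne_top hfin (hN.trans ?_))
    simp
  have hne : e ≠ 0 := by rintro rfl; simp at he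
  have hmp := measurePreserving_smul_add_orthogonal he
  have hD : Continuous fun x => fderiv ℝ φ x e :=
    (hφ.continuous_fderiv one_ne_zero).clm_apply continuous_const
  have hint : Integrable (S.indicator fun x => fderiv ℝ φ x e) :=
    (hD.integrable_of_hasCompactSupport (hc.fderiv_apply ℝ e)).indicator hS
  have hint' := (hmp.integrable_comp hint.aestronglyMeasurable).2 hint
  have hcov : ∫ x in S, fderiv ℝ φ x e =
      ∫ y : P, ∫ s : ℝ, S.indicator (fun x => fderiv ℝ φ x e) (s • e + (y : E)) := by
    rw [← integral_indicator hS, ← hmp.map_eq, integral_map hmp.measurable.aemeasurable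
      (by rw [hmp.map_eq]; exact hint.aestronglyMeasurable)]
    exact integral_prod_symm _ hint'
  rw [hcov]
  refine (enorm_integral_le_lintegral_enorm _).trans (le_trans ?_ hG)
  refine lintegral_mono_ae ?_
  filter_upwards [hNfin] with y hy
  let ι : ℝ → E := fun s => s • e + (y : E)
  have hι : Function.Injective ι := by
    intro s t hst
    exact smul_left_injective ℝ hne (add_right_cancel hst)
  have hιc : Continuous ι := by fun_prop
  let T : Set ℝ := ι ⁻¹' S
  have hfinite : (ι ⁻¹' frontier S).Finite := by
    by_contra hinf
    obtain ⟨k, hk⟩ := ENNReal.exists_nat_gt hy.ne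
    obtain ⟨t, ht, htk⟩ := Set.Infinite.exists_subset_card_eq hinf k
    have := hNs y (t.map ⟨ι, hι⟩) (by
      intro x hx
      obtain ⟨s, hs, rfl⟩ := Finset.mem_map.1 hx
      exact ⟨ht hs, hp s y⟩)
    simp only [Finset.sum_const, Finset.card_map, htk, nsmul_eq_mul, mul_one] at this
    exact absurd this (not_le.2 hk)
  have hψ : ContDiff ℝ 1 (φ ∘ ι) := hφ.comp (by fun_prop)
  have hemb : Topology.IsClosedEmbedding ι := by
    have h1 : Topology.IsClosedEmbedding fun s : ℝ => s • e := isClosedEmbedding_smul_left hne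
    exact (Homeomorph.addRight (y : E)).isClosedEmbedding.comp h1
  have hcψ : HasCompactSupport (φ ∘ ι) := hc.comp_isClosedEmbedding hemb
  have hderiv : ∀ s, deriv (φ ∘ ι) s = fderiv ℝ φ (ι s) e := by
    intro s
    have h1 : HasDerivAt ι e s := by
      simpa [ι] using! ((hasDerivAt_id s).smul_const e).add_const (y : E)
    exact (((hφ.differentiable one_ne_zero) (ι s)).hasFDerivAt.comp_hasDerivAt s h1).deriv
  have hTm : MeasurableSet T := hιc.measurable hS
  have hinner : ∫ s : ℝ, S.indicator (fun x => fderiv ℝ φ x e) (s • e + (y : E)) =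
      ∫ s in T, deriv (φ ∘ ι) s := by
    rw [← integral_indicator hTm]
    refine integral_congr_ae (Eventually.of_forall fun s => ?_)
    simp only [indicator, hderiv]
    rfl
  rw [hinner]
  have h1 := abs_setIntegral_deriv_le_sum hψ hcψ hfinite.toFinset T hTm (by
    rw [hfinite.coe_toFinset]
    exact hιc.frontier_preimage_subset S)
  have h2 := hGs y (hfinite.toFinset.map ⟨ι, hι⟩) (by
      intro x hx
      obtain ⟨s, hs, rfl⟩ := Finset.mem_map.1 hx
      exact ⟨by simpa using hs, hp s y⟩)
  refine le_trans ?_ h2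
  rw [Finset.sum_map]
  simp only [Function.Embedding.coeFn_mk, ← ofReal_norm, Real.norm_eq_abs]
  rw [← ENNReal.ofReal_sum_of_nonneg fun _ _ => abs_nonneg _]
  exact ENNReal.ofReal_le_ofReal h1

end Direction

/-! ### Smooth partitions of unity on compact sets -/

theorem exists_smooth_partition {E : Type*} [NormedAddCommGroup E] [NormedSpace ℝ E]
    [FiniteDimensional ℝ E] {K : Set E} (hK : IsCompact K) (U : E → Set E)
    (hUo : ∀ x ∈ K, IsOpen (U x)) (hU : ∀ x ∈ K, x ∈ U x) :
    ∃ (s : Finset E) (χ : s → E → ℝ), (∀ i : s, (i : E) ∈ K ∧ ContDiff ℝ ∞ (χ i) ∧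
      HasCompactSupport (χ i) ∧ tsupport (χ i) ⊆ U i ∧ ∀ x, 0 ≤ χ i x) ∧
      (∀ x ∈ K, ∑ i, χ i x = 1) ∧ ∀ x, ∑ i, χ i x ≤ 1 := by
  obtain ⟨s, hsK, hs⟩ := hK.elim_nhds_subcover (fun x => U x ∩ ball x 1) fun x hx =>
    ((hUo x hx).inter isOpen_ball).mem_nhds ⟨hU x hx, mem_ball_self one_pos⟩
  obtain ⟨f, hf⟩ := SmoothPartitionOfUnity.exists_isSubordinate 𝓘(ℝ, E) (ι := s) hK.isClosed
    (fun i => U i ∩ ball (i : E) 1) (fun i => (hUo _ (hsK i i.2)).inter isOpen_ball) (by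
      intro x hx
      obtain ⟨i, hi, hxi⟩ := mem_iUnion₂.1 (hs hx)
      exact mem_iUnion.2 ⟨⟨i, hi⟩, hxi⟩)
  refine ⟨s, fun i => f i, fun i : s => ⟨hsK i i.2, (f i).contMDiff.contDiff, ?_,
    (hf i).trans inter_subset_left, fun x => f.nonneg i x⟩, fun x hx => ?_, fun x => ?_⟩
  · exact (isCompact_closedBall (i : E) 1).of_isClosed_subset (isClosed_tsupport _)
      (((hf i).trans inter_subset_right).trans ball_subset_closedBall)
  · rw [← finsum_eq_sum_of_fintype]
    exact f.sum_eq_one hx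
  · rw [← finsum_eq_sum_of_fintype]
    exact f.sum_le_one x

variable {n : ℕ}

/-! ### Divergence -/

theorem sum_mul_apply_unitVec (L : Eucl n →L[ℝ] ℝ) (v : Eucl n) :
    ∑ i, v i * L (unitVec i) = L v := by
  conv_rhs => rw [← (EuclideanSpace.basisFun (Fin n) ℝ).sum_repr v]
  simp [unitVec]

theorem norm_unitVec (i : Fin n) : ‖(unitVec i : Eucl n)‖ = 1 := by simp [unitVec]

theorem divergence_add {X Y : Eucl n → Eucl n} {x : Eucl n} (hX : DifferentiableAt ℝ X x)
    (hY : DifferentiableAt ℝ Y x) :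
    divergence (fun y => X y + Y y) x = divergence X x + divergence Y x := by
  simp only [divergence, fderiv_fun_add hX hY, ← Finset.sum_add_distrib]
  rfl

theorem divergence_sum {ι : Type*} (s : Finset ι) {X : ι → Eucl n → Eucl n} {x : Eucl n}
    (hX : ∀ i ∈ s, DifferentiableAt ℝ (X i) x) :
    divergence (fun y => ∑ i ∈ s, X i y) x = ∑ i ∈ s, divergence (X i) x := by
  simp only [divergence, fderiv_fun_sum hX]
  rw [Finset.sum_comm]
  simp

theorem divergence_smul {χ : Eucl n → ℝ} {X : Eucl n → Eucl n} {x : Eucl n}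
    (hχ : DifferentiableAt ℝ χ x) (hX : DifferentiableAt ℝ X x) :
    divergence (fun y => χ y • X y) x = χ x * divergence X x + fderiv ℝ χ x (X x) := by
  simp only [divergence, fderiv_fun_smul hχ hX, ← sum_mul_apply_unitVec (fderiv ℝ χ x) (X x),
    Finset.mul_sum, ← Finset.sum_add_distrib]
  refine Finset.sum_congr rfl fun i _ => ?_
  simp [mul_comm]

theorem divergence_const (c : Eucl n) (x : Eucl n) : divergence (fun _ => c) x = 0 := by
  simp [divergence]

theorem divergence_eq_sum_fderiv_apply {X : Eucl n → Eucl n} {x : Eucl n}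
    (hX : DifferentiableAt ℝ X x) :
    divergence X x = ∑ i, fderiv ℝ (fun y => X y i) x (unitVec i) := by
  refine Finset.sum_congr rfl fun i _ => ?_
  have h := ((EuclideanSpace.proj i : Eucl n →L[ℝ] ℝ).hasFDerivAt (x := X x)).comp x hX.hasFDerivAt
  have h' : HasFDerivAt (fun y => X y i) ((EuclideanSpace.proj i : Eucl n →L[ℝ] ℝ).comp
    (fderiv ℝ X x)) x := h
  rw [h'.fderiv]
  rfl

theorem continuous_divergence {X : Eucl n → Eucl n} (hX : ContDiff ℝ 1 X) :
    Continuous (divergence X) := by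
  refine continuous_finsetSum _ fun i _ => ?_
  exact (EuclideanSpace.proj i : Eucl n →L[ℝ] ℝ).continuous.comp
    ((hX.continuous_fderiv one_ne_zero).clm_apply continuous_const)

theorem hasCompactSupport_divergence {X : Eucl n → Eucl n} (hX : HasCompactSupport X) :
    HasCompactSupport (divergence X) := by
  refine (hX.fderiv ℝ).mono' ?_
  intro x hx
  by_contra h
  exact hx (by simp [divergence, image_eq_zero_of_notMem_tsupport h])

/-! ### The divergence theorem inequality -/

/-- Surface measure on the topological boundary of `S`: the normalized `(n-1)`-dimensional
Hausdorff measure restricted to `frontier S`. -/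
noncomputable def surfaceMeasure (S : Set (Eucl n)) : Measure (Eucl n) :=
  (Measure.euclideanHausdorffMeasure (n - 1)).restrict (frontier S)

theorem surfaceMeasure_univ (S : Set (Eucl n)) : surfaceMeasure S univ = boundaryMeasure S := by
  simp [surfaceMeasure, boundaryMeasure]

theorem abs_setIntegral_fderiv_le {S : Set (Eucl n)} (hS : MeasurableSet S)
    (hfin : boundaryMeasure S ≠ ⊤) (v : Eucl n) {φ : Eucl n → ℝ} (hφ : ContDiff ℝ 1 φ)
    (hc : HasCompactSupport φ) :
    |∫ x in S, fderiv ℝ φ x v| ≤ ‖v‖ * ∫ x, |φ x| ∂surfaceMeasure S := by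
  rcases eq_or_ne v 0 with rfl | hv
  · simp
  have hfinm : IsFiniteMeasure (surfaceMeasure S) :=
    ⟨by rw [surfaceMeasure_univ]; exact hfin.lt_top⟩
  have hint : Integrable φ (surfaceMeasure S) := hφ.continuous.integrable_of_hasCompactSupport hc
  have hv' : 0 < ‖v‖ := norm_pos_iff.2 hv
  have he : ‖‖v‖⁻¹ • v‖ = 1 := by rw [norm_smul, norm_inv, norm_norm, inv_mul_cancel₀ hv'.ne']
  have h := enorm_setIntegral_fderiv_le hS (by simpa [boundaryMeasure] using hfin) he hφ hc
  simp only [map_smul, smul_eq_mul, finrank_euclideanSpace, Fintype.card_fin] at h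
  rw [integral_const_mul] at h
  have h2 : ∫⁻ x, ‖φ x‖ₑ ∂surfaceMeasure S = ENNReal.ofReal (∫ x, |φ x| ∂surfaceMeasure S) := by
    rw [← ofReal_integral_norm_eq_lintegral_enorm hint]
    rfl
  change _ ≤ ∫⁻ x, ‖φ x‖ₑ ∂surfaceMeasure S at h
  rw [h2, ← ofReal_norm, ENNReal.ofReal_le_ofReal_iff (integral_nonneg fun _ => abs_nonneg _),
    Real.norm_eq_abs, abs_mul, abs_inv, abs_norm, inv_mul_le_iff₀ hv'] at h
  exact h

/-- Divergence theorem inequality, with the sharp constant one, on a set whose topological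
boundary has finite Hausdorff measure and no further regularity. On the small pieces of a
partition of unity the field is almost constant, and a constant field only involves the derivative
in one direction. -/
theorem setIntegral_divergence_le {S : Set (Eucl n)} (hS : MeasurableSet S)
    (hfin : boundaryMeasure S ≠ ⊤) {X : Eucl n → Eucl n} (hX : ContDiff ℝ 1 X)
    (hc : HasCompactSupport X) :
    ∫ x in S, divergence X x ≤ ∫ x, ‖X x‖ ∂surfaceMeasure S := by
  have hfinm : IsFiniteMeasure (surfaceMeasure S) :=
    ⟨by rw [surfaceMeasure_univ]; exact hfin.lt_top⟩
  have hXint : Integrable X (surfaceMeasure S) := hX.continuous.integrable_of_hasCompactSupport hc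
  -- The main part of each piece costs one error `ε`, and bounding the remainder coordinate by
  -- coordinate costs `n` of them.
  have key : ∀ ε > 0, ∫ x in S, divergence X x ≤
      (∫ x, ‖X x‖ ∂surfaceMeasure S) + ε * ((n + 1) * (surfaceMeasure S).real univ) := by
    intro ε hε
    obtain ⟨s, χ, hχ, hsum, hle⟩ := exists_smooth_partition hc
      (fun x => {y | ‖X y - X x‖ < ε})
      (fun x _ => isOpen_lt (hX.continuous.sub continuous_const).norm continuous_const)
      (fun x _ => by simpa using hε)
    have hχ1 : ∀ i, ContDiff ℝ 1 (χ i) := fun i => (hχ i).2.1.of_le (by norm_cast)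
    have hχd : ∀ i, Differentiable ℝ (χ i) := fun i => (hχ1 i).differentiable one_ne_zero
    have hXd : Differentiable ℝ X := hX.differentiable one_ne_zero
    have hχint : ∀ i, Integrable (χ i) (surfaceMeasure S) := fun i =>
      (hχ1 i).continuous.integrable_of_hasCompactSupport (hχ i).2.2.1
    have hXeq : X = fun x => ∑ i, (χ i x • X i + χ i x • (X x - X i)) := by
      funext x
      simp only [← smul_add, add_sub_cancel, ← Finset.sum_smul]
      by_cases hx : x ∈ tsupport X
      · rw [hsum x hx, one_smul]
      · rw [image_eq_zero_of_notMem_tsupport hx, smul_zero]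
    have hdiv : ∀ x, divergence X x = ∑ i, (fderiv ℝ (χ i) x (X i) +
        divergence (fun y => χ i y • (X y - X i)) x) := by
      intro x
      have hd1 : ∀ i, DifferentiableAt ℝ (fun y => χ i y • X (i : Eucl n)) x := fun i =>
        (hχd i x).smul_const _
      have hd2 : ∀ i, DifferentiableAt ℝ (fun y => χ i y • (X y - X i)) x := fun i =>
        (hχd i x).smul ((hXd x).sub_const _)
      conv_lhs => rw [hXeq]
      rw [divergence_sum _ fun i _ => (hd1 i).fun_add (hd2 i)]
      refine Finset.sum_congr rfl fun i _ => ?_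
      rw [divergence_add (hd1 i) (hd2 i), divergence_smul (hχd i x) (by fun_prop),
        divergence_const, mul_zero, zero_add]
    have hYc : ∀ i, ContDiff ℝ 1 fun y => χ i y • (X y - X i) := fun i =>
      (hχ1 i).smul (hX.sub contDiff_const)
    have hYs : ∀ i, HasCompactSupport fun y => χ i y • (X y - X i) := fun i =>
      (hχ i).2.2.1.smul_right
    have hi1 : ∀ i, IntegrableOn (fun x => fderiv ℝ (χ i) x (X i)) S := fun i =>
      ((((hχ1 i).continuous_fderiv one_ne_zero).clm_apply
        continuous_const).integrable_of_hasCompactSupport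
        ((hχ i).2.2.1.fderiv_apply ℝ _)).integrableOn
    have hi2 : ∀ i, IntegrableOn (fun x => divergence (fun y => χ i y • (X y - X i)) x) S :=
      fun i => ((continuous_divergence (hYc i)).integrable_of_hasCompactSupport
        (hasCompactSupport_divergence (hYs i))).integrableOn
    -- the oscillation of `X` is at most `ε` on the support of each cutoff
    have hosc : ∀ i x, χ i x * ‖X x - X i‖ ≤ χ i x * ε := by
      intro i x
      by_cases hx : x ∈ tsupport (χ i)
      · exact mul_le_mul_of_nonneg_left (le_of_lt ((hχ i).2.2.2.1 hx)) ((hχ i).2.2.2.2 x)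
      · simp [image_eq_zero_of_notMem_tsupport hx]
    have hb1 : ∀ i, ∫ x in S, fderiv ℝ (χ i) x (X i) ≤
        ∫ x, χ i x * (‖X x‖ + ε) ∂surfaceMeasure S := by
      intro i
      refine (le_abs_self _).trans ((abs_setIntegral_fderiv_le hS hfin (X i) (hχ1 i)
        (hχ i).2.2.1).trans ?_)
      rw [← integral_const_mul]
      refine integral_mono ((hχint i).abs.const_mul _) ?_ fun x => ?_
      · exact ((hχ1 i).continuous.mul
          (hX.continuous.norm.add continuous_const)).integrable_of_hasCompactSupport
          (hχ i).2.2.1.mul_right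
      · have h0 := (hχ i).2.2.2.2 x
        have h1 := hosc i x
        have h2 : ‖X i‖ ≤ ‖X x‖ + ‖X x - X i‖ := norm_le_norm_add_norm_sub (X x) (X i)
        simp only [abs_of_nonneg h0]
        nlinarith
    have hb2 : ∀ i, ∫ x in S, divergence (fun y => χ i y • (X y - X i)) x ≤
        ∫ x, χ i x * (n * ε) ∂surfaceMeasure S := by
      intro i
      have hYj : ∀ j : Fin n, ContDiff ℝ 1 fun y => (χ i y • (X y - X i)) j := fun j =>
        (EuclideanSpace.proj j : Eucl n →L[ℝ] ℝ).contDiff.comp (hYc i)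
      have hYjs : ∀ j : Fin n, HasCompactSupport fun y => (χ i y • (X y - X i)) j := fun j =>
        (hYs i).comp_left (g := fun v : Eucl n => v j) (by simp)
      have hcomp : ∀ j : Fin n,
          ∫ x in S, fderiv ℝ (fun y => (χ i y • (X y - X i)) j) x (unitVec j) ≤
            ∫ x, χ i x * ε ∂surfaceMeasure S := by
        intro j
        refine (le_abs_self _).trans ((abs_setIntegral_fderiv_le hS hfin (unitVec j) (hYj j)
          (hYjs j)).trans ?_)
        rw [norm_unitVec, one_mul]
        refine integral_mono
          ((hYj j).continuous.integrable_of_hasCompactSupport (hYjs j)).abs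
          ((hχint i).mul_const _) fun x => ?_
        refine le_trans ?_ (hosc i x)
        have h1 := PiLp.norm_apply_le (χ i x • (X x - X i)) j
        rwa [norm_smul, Real.norm_eq_abs, Real.norm_eq_abs, abs_of_nonneg ((hχ i).2.2.2.2 x)] at h1
      have hsplit : ∀ x, divergence (fun y => χ i y • (X y - X i)) x =
          ∑ j, fderiv ℝ (fun y => (χ i y • (X y - X i)) j) x (unitVec j) := fun x =>
        divergence_eq_sum_fderiv_apply ((hYc i).differentiable one_ne_zero x)
      simp only [hsplit]
      rw [integral_finsetSum]
      · refine (Finset.sum_le_sum fun j _ => hcomp j).trans (le_of_eq ?_)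
        simp only [Finset.sum_const, Finset.card_univ, Fintype.card_fin, nsmul_eq_mul,
          integral_mul_const]
        ring
      · intro j _
        exact ((((hYj j).continuous_fderiv one_ne_zero).clm_apply
          continuous_const).integrable_of_hasCompactSupport
          ((hYjs j).fderiv_apply ℝ _)).integrableOn
    have hi3 : ∀ i, Integrable (fun x => χ i x * (‖X x‖ + ε)) (surfaceMeasure S) := fun i =>
      ((hχ1 i).continuous.mul
          (hX.continuous.norm.add continuous_const)).integrable_of_hasCompactSupport
          (hχ i).2.2.1.mul_right
    calc ∫ x in S, divergence X x
        = ∑ i, ((∫ x in S, fderiv ℝ (χ i) x (X i)) +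
          ∫ x in S, divergence (fun y => χ i y • (X y - X i)) x) := by
          simp only [hdiv]
          rw [integral_finsetSum]
          · exact Finset.sum_congr rfl fun i _ => integral_add (hi1 i) (hi2 i)
          · exact fun i _ => (hi1 i).add (hi2 i)
      _ ≤ ∑ i, ((∫ x, χ i x * (‖X x‖ + ε) ∂surfaceMeasure S) +
          ∫ x, χ i x * (n * ε) ∂surfaceMeasure S) :=
          Finset.sum_le_sum fun i _ => add_le_add (hb1 i) (hb2 i)
      _ = ∫ x, ∑ i, χ i x * (‖X x‖ + (n + 1) * ε) ∂surfaceMeasure S := by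
          rw [integral_finsetSum]
          · refine Finset.sum_congr rfl fun i _ => ?_
            rw [← integral_add (hi3 i) ((hχint i).mul_const _)]
            congr 1
            funext x
            ring
          · intro i _
            convert! (hi3 i).add ((hχint i).mul_const (n * ε)) using 2
            simp only [Pi.add_apply]
            ring
      _ ≤ ∫ x, (‖X x‖ + (n + 1) * ε) ∂surfaceMeasure S := by
          refine integral_mono_of_nonneg (Eventually.of_forall fun x =>
            Finset.sum_nonneg fun i _ => mul_nonneg ((hχ i).2.2.2.2 x) (by positivity))
            (hXint.norm.add (integrable_const _)) (Eventually.of_forall fun x => ?_)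
          simp only [← Finset.sum_mul]
          exact mul_le_of_le_one_left (by positivity) (hle x)
      _ = _ := by
          rw [integral_add hXint.norm (integrable_const _), integral_const, smul_eq_mul]
          ring
  refine le_of_forall_pos_le_add fun δ hδ => ?_
  have hM : 0 ≤ (n + 1 : ℝ) * (surfaceMeasure S).real univ := by positivity
  refine (key (δ / ((n + 1 : ℝ) * (surfaceMeasure S).real univ + 1)) (by positivity)).trans ?_
  gcongr
  rw [div_mul_eq_mul_div, div_le_iff₀ (by positivity)]
  nlinarith

/-! ### Shifts into a set with Lipschitz boundary -/

/-- Near any point, a shift of `closure U` in a suitable direction, by a small distance, moves it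
into `U` with a margin proportional to the distance: at a boundary point the direction is the axis
of the graph. At the other points no shift is needed, and `e = 0`. -/
theorem exists_inward_shift {U : Set (Eucl n)} (hUo : IsOpen U) (hU : HasLipschitzBoundary U)
    (x : Eucl n) : ∃ (e : Eucl n) (r c t₀ : ℝ), 0 < r ∧ 0 < c ∧ 0 < t₀ ∧
      ∀ y ∈ closure U ∩ ball x r, ∀ t ∈ Ioo 0 t₀, closedBall (y + t • e) (c * t) ⊆ U := by
  by_cases hxU : x ∈ U
  · obtain ⟨r, hr, hball⟩ := Metric.isOpen_iff.1 hUo x hxU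
    refine ⟨0, r / 2, 1, r / 2, by positivity, one_pos, by positivity, ?_⟩
    rintro y ⟨-, hy⟩ t ht z hz
    refine hball ?_
    rw [smul_zero, add_zero, one_mul, mem_closedBall] at hz
    rw [mem_ball] at hy ⊢
    linarith [dist_triangle z y x, ht.2]
  by_cases hxc : x ∈ closure U
  swap
  · obtain ⟨r, hr, hball⟩ := Metric.isOpen_iff.1 isClosed_closure.isOpen_compl x hxc
    exact ⟨0, r, 1, 1, hr, one_pos, one_pos, fun y hy => absurd hy.1 (hball hy.2)⟩
  obtain ⟨e, he, K, γ, hγ, r, hr, hgraph⟩ := hU x ⟨hxc, by rwa [hUo.interior_eq]⟩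
  have hK2 : (0 : ℝ) < K + 2 := by positivity
  have hc1 : ((K : ℝ) + 2)⁻¹ ≤ 1 := inv_le_one_of_one_le₀ (by linarith [K.coe_nonneg])
  -- The margin `c = 1 / (K + 2)` works because `(K + 1) c < 1`: a displacement by `w` lowers the
  -- height above the graph by at most `(K + 1) ‖w‖`.
  refine ⟨e, r / 2, ((K : ℝ) + 2)⁻¹, r / 4, by positivity, by positivity, by positivity, ?_⟩
  rintro y ⟨hyc, hy⟩ t ⟨ht0, ht⟩ z hz
  have hyr : y ∈ ball x r := ball_subset_ball (by linarith) hy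
  have hproj : Continuous fun v : Eucl n => v - inner ℝ e v • e := by fun_prop
  have hheight : γ (y - inner ℝ e y • e) ≤ inner ℝ e y := by
    have h1 : y ∈ closure (U ∩ ball x r) := isOpen_ball.closure_inter ⟨hyc, hyr⟩
    refine closure_minimal (s := U ∩ ball x r)
      (t := {v | γ (v - inner ℝ e v • e) ≤ inner ℝ e v}) ?_
      (isClosed_le (hγ.continuous.comp hproj) (by fun_prop)) h1
    rintro v ⟨hvU, hv⟩
    exact ((hgraph v hv).1 hvU).le
  set w : Eucl n := z - (y + t • e) with hw
  have hwn : ‖w‖ ≤ ((K : ℝ) + 2)⁻¹ * t := by rwa [mem_closedBall, dist_eq_norm] at hz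
  have hzw : z = y + t • e + w := by rw [hw]; abel
  have hzr : z ∈ ball x r := by
    rw [mem_ball, dist_eq_norm] at hy ⊢
    have h1 : z - x = (y - x) + t • e + w := by rw [hzw]; abel
    have h2 : ‖t • e‖ = t := by rw [norm_smul, he, mul_one, Real.norm_of_nonneg ht0.le]
    have h3 : ((K : ℝ) + 2)⁻¹ * t ≤ t := mul_le_of_le_one_left ht0.le hc1
    rw [h1]
    linarith [norm_add_le (y - x + t • e) w, norm_add_le (y - x) (t • e)]
  rw [hgraph z hzr]
  have hee : inner ℝ e e = (1 : ℝ) := by rw [real_inner_self_eq_norm_sq, he]; norm_num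
  have hinner : inner ℝ e z = inner ℝ e y + t + inner ℝ e w := by
    rw [hzw, inner_add_right, inner_add_right, inner_smul_right, hee, mul_one]
  have hiw : |inner ℝ e w| ≤ ‖w‖ := by
    simpa [he] using abs_real_inner_le_norm e w
  have hpz : (z - inner ℝ e z • e) - (y - inner ℝ e y • e) = w - inner ℝ e w • e := by
    rw [hinner, hzw]
    module
  have hpw : ‖w - inner ℝ e w • e‖ ≤ ‖w‖ := by
    refine abs_le_of_sq_le_sq' ?_ (norm_nonneg _) |>.2
    rw [norm_sub_sq_real, inner_smul_right, norm_smul, he, real_inner_comm, Real.norm_eq_abs,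
      mul_one, sq_abs]
    nlinarith [sq_nonneg (inner ℝ e w : ℝ)]
  have hγz : γ (z - inner ℝ e z • e) ≤ γ (y - inner ℝ e y • e) + K * ‖w‖ := by
    have h1 := hγ.dist_le_mul (z - inner ℝ e z • e) (y - inner ℝ e y • e)
    rw [Real.dist_eq, dist_eq_norm, hpz] at h1
    have h2 : (K : ℝ) * ‖w - inner ℝ e w • e‖ ≤ K * ‖w‖ := by gcongr
    linarith [le_abs_self (γ (z - inner ℝ e z • e) - γ (y - inner ℝ e y • e))]
  have hlt : (K + 1) * ‖w‖ < t := by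
    calc (K + 1) * ‖w‖ ≤ (K + 1) * (((K : ℝ) + 2)⁻¹ * t) := by gcongr
      _ = ((K + 1) / (K + 2)) * t := by ring
      _ < 1 * t := by
          gcongr
          rw [div_lt_one hK2]
          linarith
      _ = t := one_mul t
  have := neg_abs_le (inner ℝ e w : ℝ)
  linarith

/-! ### Mollification -/

/-- The convolution of a vector field with a normalized smooth bump function. -/
noncomputable def mollify (φ : ContDiffBump (0 : Eucl n)) (V : Eucl n → Eucl n) :
    Eucl n → Eucl n :=
  φ.normed volume ⋆[ContinuousLinearMap.lsmul ℝ ℝ, volume] V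

theorem mollify_apply (φ : ContDiffBump (0 : Eucl n)) (V : Eucl n → Eucl n) (p : Eucl n) :
    mollify φ V p = ∫ z, φ.normed volume (p - z) • V z :=
  convolution_lsmul_swap

theorem contDiff_mollify (φ : ContDiffBump (0 : Eucl n)) {V : Eucl n → Eucl n}
    (hV : LocallyIntegrable V) : ContDiff ℝ 1 (mollify φ V) :=
  φ.hasCompactSupport_normed.contDiff_convolution_left (n := 1) _ φ.contDiff_normed hV

theorem integral_normed_sub (φ : ContDiffBump (0 : Eucl n)) (p : Eucl n) :
    ∫ z, φ.normed volume (p - z) = 1 := by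
  rw [integral_sub_left_eq_self (fun z => φ.normed volume z), φ.integral_normed]

theorem norm_mollify_le (φ : ContDiffBump (0 : Eucl n)) {V : Eucl n → Eucl n}
    (hV : ∀ᵐ x, ‖V x‖ ≤ 1) (p : Eucl n) : ‖mollify φ V p‖ ≤ 1 := by
  rw [mollify_apply, ← integral_normed_sub φ p]
  refine norm_integral_le_of_norm_le (φ.integrable_normed.comp_sub_left p) ?_
  filter_upwards [hV] with z hz
  rw [norm_smul, Real.norm_of_nonneg (φ.nonneg_normed _)]
  exact mul_le_of_le_one_right (φ.nonneg_normed _) hz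

theorem fderiv_mollify_apply (φ : ContDiffBump (0 : Eucl n)) {V : Eucl n → Eucl n}
    (hV : LocallyIntegrable V) (p v : Eucl n) :
    Integrable (fun z => fderiv ℝ (φ.normed volume) (p - z) v • V z) ∧
    fderiv ℝ (mollify φ V) p v = ∫ z, fderiv ℝ (φ.normed volume) (p - z) v • V z := by
  have hc := φ.hasCompactSupport_normed (μ := (volume : Measure (Eucl n)))
  have hd : ContDiff ℝ 1 (φ.normed (volume : Measure (Eucl n))) := φ.contDiff_normed (n := 1)
  have h := hc.hasFDerivAt_convolution_left (ContinuousLinearMap.lsmul ℝ ℝ) hd hV p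
  have hex := ((hc.fderiv ℝ).convolutionExists_left
    ((ContinuousLinearMap.lsmul ℝ ℝ : ℝ →L[ℝ] Eucl n →L[ℝ] Eucl n).precompL (Eucl n))
    (hd.continuous_fderiv one_ne_zero) hV p).integrable_swap
  refine ⟨?_, ?_⟩
  · simpa using hex.apply_continuousLinearMap v
  · change fderiv ℝ (φ.normed volume ⋆[ContinuousLinearMap.lsmul ℝ ℝ, volume] V) p v = _
    rw [h.fderiv, convolution_eq_swap, ContinuousLinearMap.integral_apply hex]
    simp

theorem divergence_mollify (φ : ContDiffBump (0 : Eucl n)) {V : Eucl n → Eucl n}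
    (hV : LocallyIntegrable V) (p : Eucl n) :
    divergence (mollify φ V) p =
      ∫ z, ∑ i, V z i * fderiv ℝ (φ.normed volume) (p - z) (unitVec i) := by
  have h := fun i : Fin n => fderiv_mollify_apply φ hV p (unitVec i)
  have hi : ∀ i : Fin n, Integrable
      fun z => V z i * fderiv ℝ (φ.normed volume) (p - z) (unitVec i) := by
    intro i
    have := (EuclideanSpace.proj i : Eucl n →L[ℝ] ℝ).integrable_comp (h i).1
    simpa [mul_comm] using this
  rw [integral_finsetSum _ fun i _ => hi i]
  refine Finset.sum_congr rfl fun i _ => ?_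
  rw [(h i).2]
  have := (EuclideanSpace.proj i : Eucl n →L[ℝ] ℝ).integral_comp_comm (h i).1
  refine Eq.trans this.symm (integral_congr_ae (Eventually.of_forall fun z => ?_))
  simp [mul_comm]

/-- The kernel of the mollification at `p` is an admissible test function as soon as its support, a
ball about `p`, lies in `Ω`. -/
theorem le_divergence_mollify {Ω : Opens (Eucl n)} {V : Eucl n → Eucl n} {h : ℝ}
    (hV : LocallyIntegrable ((Ω : Set (Eucl n)).indicator V)) (hdiv : DistribDivGE Ω V h)
    (φ : ContDiffBump (0 : Eucl n)) {p : Eucl n} (hp : closedBall p φ.rOut ⊆ Ω) :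
    h ≤ divergence (mollify φ ((Ω : Set (Eucl n)).indicator V)) p := by
  have hsupp : tsupport (fun z => φ.normed volume (p - z)) ⊆ closedBall p φ.rOut := by
    refine closure_minimal ?_ isClosed_closedBall
    intro z hz
    have h1 : p - z ∈ Function.support (φ.normed (volume : Measure (Eucl n))) := hz
    rw [φ.support_normed_eq, mem_ball_zero_iff, ← dist_eq_norm, dist_comm] at h1
    exact h1.le
  let η : 𝓓(Ω, ℝ) :=
    { toFun := fun z => φ.normed volume (p - z)
      contDiff' := φ.contDiff_normed.comp (contDiff_const.sub contDiff_id)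
      hasCompactSupport' :=
        (isCompact_closedBall p φ.rOut).of_isClosed_subset (isClosed_tsupport _) hsupp
      tsupport_subset' := hsupp.trans hp }
  have hη : ∀ z, η z = φ.normed volume (p - z) := fun z => rfl
  have h1 := hdiv η fun z => φ.nonneg_normed _
  have h2 : ∫ x in (Ω : Set (Eucl n)), η x = 1 := by
    rw [setIntegral_eq_integral_of_forall_compl_eq_zero, ← integral_normed_sub φ p]
    · rfl
    · intro z hz
      exact image_eq_zero_of_notMem_tsupport fun hz' => hz (η.tsupport_subset hz')
  have hd : ∀ z v, fderiv ℝ η z v = -fderiv ℝ (φ.normed volume) (p - z) v := by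
    intro z v
    have hdiff : DifferentiableAt ℝ (φ.normed (volume : Measure (Eucl n))) (p - z) :=
      (φ.contDiff_normed (n := 1)).differentiable one_ne_zero _
    have h3 : HasFDerivAt (fun z => φ.normed volume (p - z)) _ z :=
      hdiff.hasFDerivAt.comp z ((hasFDerivAt_const p z).sub (hasFDerivAt_id z))
    have h4 : fderiv ℝ η z = _ := h3.fderiv
    rw [h4]
    simp
  rw [h2, mul_one] at h1
  refine h1.trans (le_of_eq ?_)
  rw [divergence_mollify φ hV, distribDiv, ← integral_neg,
    ← integral_indicator Ω.isOpen.measurableSet]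
  congr 1
  funext z
  by_cases hz : z ∈ (Ω : Set (Eucl n))
  · simp [hz, hd]
  · simp [hz]

/-- Mollifications evaluated at points shifted by a distance comparable with the radius of the
kernel still converge almost everywhere, as the Lebesgue differentiation theorem allows balls that
are not centered at the point. -/
theorem ae_tendsto_mollify_shift {V : Eucl n → Eucl n} (hV : LocallyIntegrable V)
    (φ : ℕ → ContDiffBump (0 : Eucl n)) (a : ℕ → Eucl n) {K M : ℝ}
    (hφ : Tendsto (fun m => (φ m).rOut) atTop (𝓝 0))
    (hK : ∀ m, (φ m).rOut ≤ K * (φ m).rIn) (ha : ∀ m, ‖a m‖ ≤ M * (φ m).rOut) :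
    ∀ᵐ x, Tendsto (fun m => mollify (φ m) V (x + a m)) atTop (𝓝 (V x)) := by
  filter_upwards [IsUnifLocDoublingMeasure.ae_tendsto_average_norm_sub volume hV M] with x hx
  have hφ' : Tendsto (fun m => (φ m).rOut) atTop (𝓝[>] 0) :=
    tendsto_nhdsWithin_iff.2 ⟨hφ, Eventually.of_forall fun m => (φ m).rOut_pos⟩
  have h1 := hx (fun m => x + a m) (fun m => (φ m).rOut) hφ'
    (Eventually.of_forall fun m => by simpa [dist_eq_norm] using ha m)
  simp only [mollify_apply]
  refine tendsto_integral_smul_of_tendsto_average_norm_sub (K ^ (Module.finrank ℝ (Eucl n))) h1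
    (Eventually.of_forall fun m => hV.integrableOn_isCompact (isCompact_closedBall _ _)) ?_
    (Eventually.of_forall fun m => ?_) (Eventually.of_forall fun m z => ?_)
  · simp only [integral_normed_sub]
    exact tendsto_const_nhds
  · intro z hz
    have h1 : x + a m - z ∈ Function.support ((φ m).normed (volume : Measure (Eucl n))) := hz
    rw [(φ m).support_normed_eq, mem_ball_zero_iff, ← dist_eq_norm, dist_comm] at h1
    exact h1.le
  · rw [abs_of_nonneg ((φ m).nonneg_normed _), Measure.addHaar_real_closedBall_center]
    exact (φ m).normed_le_div_measure_closedBall_rOut _ _ (hK m) _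

/-! ### The flux inequality up to the boundary -/

/-- The weak form, tested with `χ`, of the bound of the divergence of `V` from below by `h`, up to
the boundary of `S`: for `χ` tending to `1` it becomes `h |S| ≤ |∂S|`. -/
def FluxInequality (V : Eucl n → Eucl n) (h : ℝ) (S : Set (Eucl n)) (χ : Eucl n → ℝ) : Prop :=
  h * (∫ x in S, χ x) + ∫ x in S, fderiv ℝ χ x (V x) ≤ ∫ x, χ x ∂surfaceMeasure S

section Flux

variable {Ω : Opens (Eucl n)} {V : Eucl n → Eucl n} {h : ℝ} {S U : Set (Eucl n)}

/-- The inequality for `χ` supported where `closure U` can be shifted into `U`: there the shifted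
mollifications of `V` are smooth up to the closure of `S`, have norm at most `1` and divergence at
least `h`, and they converge to `V`. -/
theorem fluxInequality_of_tsupport_subset_ball
    (hVm : AEStronglyMeasurable V (volume.restrict (Ω : Set (Eucl n))))
    (hV1 : ∀ᵐ x ∂(volume.restrict (Ω : Set (Eucl n))), ‖V x‖ ≤ 1) (hdiv : DistribDivGE Ω V h)
    (hS : MeasurableSet S) (hSU : S ⊆ U) (hUΩ : U ⊆ Ω) (hfin : boundaryMeasure S ≠ ⊤)
    {x e : Eucl n} {r c t₀ : ℝ} (hc : 0 < c) (ht₀ : 0 < t₀)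
    (hshift : ∀ y ∈ closure U ∩ ball x r, ∀ t ∈ Ioo 0 t₀, closedBall (y + t • e) (c * t) ⊆ U)
    {χ : Eucl n → ℝ} (hχ : ContDiff ℝ 1 χ) (hχc : HasCompactSupport χ) (hχ0 : ∀ y, 0 ≤ χ y)
    (hχr : tsupport χ ⊆ ball x r) : FluxInequality V h S χ := by
  have hfinm : IsFiniteMeasure (surfaceMeasure S) :=
    ⟨by rw [surfaceMeasure_univ]; exact hfin.lt_top⟩
  set V₀ : Eucl n → Eucl n := (Ω : Set (Eucl n)).indicator V with hV₀
  have hΩm : MeasurableSet (Ω : Set (Eucl n)) := Ω.isOpen.measurableSet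
  have hV₀m : AEStronglyMeasurable V₀ := (aestronglyMeasurable_indicator_iff hΩm).2 hVm
  have hV₀1 : ∀ᵐ y, ‖V₀ y‖ ≤ 1 := by
    filter_upwards [(ae_restrict_iff' hΩm).1 hV1] with y hy
    by_cases hyΩ : y ∈ (Ω : Set (Eucl n))
    · rw [hV₀, indicator_of_mem hyΩ]; exact hy hyΩ
    · rw [hV₀, indicator_of_notMem hyΩ]; simp
  have hV₀l : LocallyIntegrable V₀ := by
    refine (locallyIntegrable_const (1 : ℝ)).mono hV₀m ?_
    filter_upwards [hV₀1] with y hy using by simpa using hy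
  -- shifts `t m • e` with `t m → 0`, mollified at the scale `c * t m` that the margin permits
  let t : ℕ → ℝ := fun m => t₀ / ((m : ℝ) + 2)
  have ht0 : ∀ m, 0 < t m := fun m => by positivity
  have htlt : ∀ m, t m ∈ Ioo 0 t₀ := fun m =>
    ⟨ht0 m, div_lt_self ht₀ (by linarith [(Nat.cast_nonneg m : (0 : ℝ) ≤ m)])⟩
  have htlim : Tendsto t atTop (𝓝 0) :=
    Tendsto.const_div_atTop (tendsto_natCast_atTop_atTop.atTop_add tendsto_const_nhds) t₀
  let φ : ℕ → ContDiffBump (0 : Eucl n) := fun m =>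
    ⟨c * t m / 2, c * t m, by have := ht0 m; positivity, half_lt_self (mul_pos hc (ht0 m))⟩
  let W : ℕ → Eucl n → Eucl n := fun m y => mollify (φ m) V₀ (y + t m • e)
  have hWc : ∀ m, ContDiff ℝ 1 (W m) := fun m =>
    (contDiff_mollify (φ m) hV₀l).comp (contDiff_id.add contDiff_const)
  have hW1 : ∀ m y, ‖W m y‖ ≤ 1 := fun m y => norm_mollify_le (φ m) hV₀1 _
  have hWlim : ∀ᵐ y, Tendsto (fun m => W m y) atTop (𝓝 (V₀ y)) := by
    refine ae_tendsto_mollify_shift hV₀l φ (fun m => t m • e) (K := 2) (M := ‖e‖ / c) ?_ ?_ ?_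
    · simpa using htlim.const_mul c
    · intro m; simp only [φ]; linarith
    · intro m
      simp only [φ, norm_smul, Real.norm_of_nonneg (ht0 m).le]
      apply le_of_eq
      field_simp
  have hWdiv : ∀ m, ∀ y ∈ S ∩ ball x r, h ≤ divergence (W m) y := by
    rintro m y ⟨hyS, hyr⟩
    have h1 : divergence (W m) y = divergence (mollify (φ m) V₀) (y + t m • e) := by
      simp only [divergence, W, fderiv_comp_add_right]
    rw [h1]
    exact le_divergence_mollify hV₀l hdiv (φ m)
      ((hshift y ⟨subset_closure (hSU hyS), hyr⟩ _ (htlt m)).trans hUΩ)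
  have hχd : Differentiable ℝ χ := hχ.differentiable one_ne_zero
  have hχi : IntegrableOn χ S := (hχ.continuous.integrable_of_hasCompactSupport hχc).integrableOn
  have hD : Continuous (fderiv ℝ χ) := hχ.continuous_fderiv one_ne_zero
  have hDi : IntegrableOn (fun y => ‖fderiv ℝ χ y‖) S :=
    (hD.integrable_of_hasCompactSupport (hχc.fderiv ℝ)).norm.integrableOn
  have hDW : ∀ m, Continuous fun y => fderiv ℝ χ y (W m y) := fun m =>
    hD.clm_apply (hWc m).continuous
  have hDWle : ∀ m y, ‖fderiv ℝ χ y (W m y)‖ ≤ ‖fderiv ℝ χ y‖ := fun m y =>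
    ((fderiv ℝ χ y).le_opNorm _).trans (mul_le_of_le_one_right (norm_nonneg _) (hW1 m y))
  have hDWi : ∀ m, IntegrableOn (fun y => fderiv ℝ χ y (W m y)) S := fun m =>
    hDi.mono' (hDW m).aestronglyMeasurable (Eventually.of_forall fun y => hDWle m y)
  have hineq : ∀ m, h * (∫ y in S, χ y) + ∫ y in S, fderiv ℝ χ y (W m y) ≤
      ∫ y, χ y ∂surfaceMeasure S := by
    intro m
    have hXc : ContDiff ℝ 1 fun y => χ y • W m y := hχ.smul (hWc m)
    have hXs : HasCompactSupport fun y => χ y • W m y := hχc.smul_right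
    calc h * (∫ y in S, χ y) + ∫ y in S, fderiv ℝ χ y (W m y)
        = ∫ y in S, (h * χ y + fderiv ℝ χ y (W m y)) := by
          rw [integral_add (hχi.const_mul h) (hDWi m), integral_const_mul]
      _ ≤ ∫ y in S, divergence (fun y => χ y • W m y) y := by
          refine setIntegral_mono_on ((hχi.const_mul h).add (hDWi m))
            ((continuous_divergence hXc).integrable_of_hasCompactSupport
              (hasCompactSupport_divergence hXs)).integrableOn hS fun y hy => ?_
          rw [divergence_smul (hχd y) ((hWc m).differentiable one_ne_zero y)]
          by_cases hyχ : y ∈ tsupport χ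
          · have h1 := mul_le_mul_of_nonneg_left (hWdiv m y ⟨hy, hχr hyχ⟩) (hχ0 y)
            linarith
          · simp [image_eq_zero_of_notMem_tsupport hyχ]
      _ ≤ ∫ y, ‖χ y • W m y‖ ∂surfaceMeasure S := setIntegral_divergence_le hS hfin hXc hXs
      _ ≤ ∫ y, χ y ∂surfaceMeasure S := by
          refine integral_mono
            (hXc.continuous.integrable_of_hasCompactSupport hXs).norm
            (hχ.continuous.integrable_of_hasCompactSupport hχc) fun y => ?_
          rw [norm_smul, Real.norm_of_nonneg (hχ0 y)]
          exact mul_le_of_le_one_right (hχ0 y) (hW1 m y)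
  have hlim : Tendsto (fun m => ∫ y in S, fderiv ℝ χ y (W m y)) atTop
      (𝓝 (∫ y in S, fderiv ℝ χ y (V₀ y))) := by
    refine tendsto_integral_of_dominated_convergence (fun y => ‖fderiv ℝ χ y‖)
      (fun m => (hDW m).aestronglyMeasurable) hDi
      (fun m => Eventually.of_forall fun y => hDWle m y) ?_
    filter_upwards [ae_restrict_of_ae hWlim] with y hy
    exact ((fderiv ℝ χ y).continuous.tendsto _).comp hy
  have heq : ∫ y in S, fderiv ℝ χ y (V y) = ∫ y in S, fderiv ℝ χ y (V₀ y) :=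
    setIntegral_congr_fun hS fun y hy => by
      simp only [hV₀, indicator_of_mem (hUΩ (hSU hy))]
  rw [FluxInequality, heq]
  exact le_of_tendsto' (hlim.const_add _) hineq

theorem fluxInequality_of_hasCompactSupport
    (hVm : AEStronglyMeasurable V (volume.restrict (Ω : Set (Eucl n))))
    (hV1 : ∀ᵐ x ∂(volume.restrict (Ω : Set (Eucl n))), ‖V x‖ ≤ 1) (hdiv : DistribDivGE Ω V h)
    (hS : MeasurableSet S) (hUo : IsOpen U) (hU : HasLipschitzBoundary U) (hSU : S ⊆ U)
    (hUΩ : U ⊆ Ω) (hfin : boundaryMeasure S ≠ ⊤)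
    {χ : Eucl n → ℝ} (hχ : ContDiff ℝ 1 χ) (hχc : HasCompactSupport χ) (hχ0 : ∀ y, 0 ≤ χ y) :
    FluxInequality V h S χ := by
  have hfinm : IsFiniteMeasure (surfaceMeasure S) :=
    ⟨by rw [surfaceMeasure_univ]; exact hfin.lt_top⟩
  choose e r c t₀ hr hc ht₀ hshift using exists_inward_shift hUo hU
  obtain ⟨s, η, hη, hsum, -⟩ := exists_smooth_partition hχc (fun x => ball x (r x))
    (fun x _ => isOpen_ball) (fun x _ => mem_ball_self (hr x))
  have hη1 : ∀ i, ContDiff ℝ 1 (η i) := fun i => (hη i).2.1.of_le (by norm_cast)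
  have hc1 : ∀ i, ContDiff ℝ 1 fun y => η i y * χ y := fun i => (hη1 i).mul hχ
  have hs1 : ∀ i, HasCompactSupport fun y => η i y * χ y := fun i => hχc.mul_left
  have hlocal : ∀ i, FluxInequality V h S fun y => η i y * χ y := fun i =>
    fluxInequality_of_tsupport_subset_ball hVm hV1 hdiv hS hSU hUΩ hfin (hc i) (ht₀ i)
      (hshift i) (hc1 i) (hs1 i)
      (fun y => mul_nonneg ((hη i).2.2.2.2 y) (hχ0 y))
      ((tsupport_mul_subset_left).trans (hη i).2.2.2.1)
  have hχeq : χ = fun y => ∑ i, η i y * χ y := by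
    funext y
    rw [← Finset.sum_mul]
    by_cases hy : y ∈ tsupport χ
    · rw [hsum y hy, one_mul]
    · rw [image_eq_zero_of_notMem_tsupport hy, mul_zero]
  have hVS1 : ∀ᵐ y ∂(volume.restrict S), ‖V y‖ ≤ 1 :=
    ae_mono (Measure.restrict_mono (hSU.trans hUΩ) le_rfl) hV1
  have hVSm : AEStronglyMeasurable V (volume.restrict S) := hVm.mono_set (hSU.trans hUΩ)
  have hDi : ∀ i, IntegrableOn (fun x => fderiv ℝ (fun y => η i y * χ y) x (V x)) S := by
    intro i
    have hD : Continuous (fderiv ℝ fun y => η i y * χ y) := (hc1 i).continuous_fderiv one_ne_zero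
    have hDn : IntegrableOn (fun x => ‖fderiv ℝ (fun y => η i y * χ y) x‖) S :=
      (hD.integrable_of_hasCompactSupport ((hs1 i).fderiv ℝ)).norm.integrableOn
    refine hDn.mono' ?_ ?_
    · exact isBoundedBilinearMap_apply.continuous.comp_aestronglyMeasurable
        (hD.aestronglyMeasurable.prodMk hVSm)
    · filter_upwards [hVS1] with y hy
      exact ((fderiv ℝ _ y).le_opNorm _).trans (mul_le_of_le_one_right (norm_nonneg _) hy)
  have hDeq : ∀ x, fderiv ℝ χ x (V x) = ∑ i, fderiv ℝ (fun y => η i y * χ y) x (V x) := by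
    intro x
    conv_lhs => rw [hχeq, fderiv_fun_sum fun i _ => (hc1 i).differentiable one_ne_zero x]
    simp
  have hI : ∀ (μ : Measure (Eucl n)) [IsFiniteMeasureOnCompacts μ],
      ∫ x, χ x ∂μ = ∑ i, ∫ x, η i x * χ x ∂μ := by
    intro μ _
    conv_lhs => rw [hχeq]
    exact integral_finsetSum _ fun i _ =>
      (hc1 i).continuous.integrable_of_hasCompactSupport (hs1 i)
  simp only [FluxInequality] at hlocal ⊢
  simp only [hDeq]
  rw [hI, hI, integral_finsetSum _ fun i _ => hDi i, Finset.mul_sum, ← Finset.sum_add_distrib]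
  exact Finset.sum_le_sum fun i _ => hlocal i

end Flux

/-! ### From the flux inequality to volumes -/

/-- The flux inequality for an integrable weight without compact support, by cutting off at radius
tending to infinity. A weight with logarithmic gradient at most `δ` costs only `δ` in the
constant. -/
theorem sub_mul_setIntegral_le_of_norm_fderiv_le {V : Eucl n → Eucl n} {h : ℝ} {S : Set (Eucl n)}
    (hV1 : ∀ᵐ x ∂(volume.restrict S), ‖V x‖ ≤ 1) (hVm : AEStronglyMeasurable V (volume.restrict S))
    (hfin : boundaryMeasure S ≠ ⊤)
    (hflux : ∀ χ : Eucl n → ℝ, ContDiff ℝ 1 χ → HasCompactSupport χ → (∀ x, 0 ≤ χ x) →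
      FluxInequality V h S χ)
    {χ : Eucl n → ℝ} {δ : ℝ} (hχ : ContDiff ℝ 1 χ) (hχi : Integrable χ) (hχ0 : ∀ x, 0 ≤ χ x)
    (hχ1 : ∀ x, χ x ≤ 1) (hχd : ∀ x, ‖fderiv ℝ χ x‖ ≤ δ * χ x) :
    (h - δ) * ∫ x in S, χ x ≤ (boundaryMeasure S).toReal := by
  have hfinm : IsFiniteMeasure (surfaceMeasure S) :=
    ⟨by rw [surfaceMeasure_univ]; exact hfin.lt_top⟩
  let η : ContDiffBump (0 : Eucl n) := ⟨1, 2, one_pos, one_lt_two⟩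
  have hηc : ContDiff ℝ 1 η := η.contDiff
  obtain ⟨C, hC⟩ := (hηc.continuous_fderiv one_ne_zero).bounded_above_of_compact_support
    (η.hasCompactSupport.fderiv ℝ)
  have hC0 : 0 ≤ C := (norm_nonneg _).trans (hC 0)
  let ρ : ℕ → ℝ := fun m => 1 / ((m : ℝ) + 1)
  have hρ0 : ∀ m, 0 < ρ m := fun m => Nat.one_div_pos_of_nat
  have hρ : Tendsto ρ atTop (𝓝 0) := tendsto_one_div_add_atTop_nhds_zero_nat
  let κ : ℕ → Eucl n → ℝ := fun m x => η (ρ m • x)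
  have hκc : ∀ m, ContDiff ℝ 1 (κ m) := fun m => hηc.comp (contDiff_const_smul _)
  have hκs : ∀ m, HasCompactSupport (κ m) := fun m => η.hasCompactSupport.comp_smul (hρ0 m).ne'
  have hκ0 : ∀ m x, 0 ≤ κ m x := fun m x => η.nonneg
  have hκ1 : ∀ m x, κ m x ≤ 1 := fun m x => η.le_one
  have hκd : ∀ m x, ‖fderiv ℝ (κ m) x‖ ≤ ρ m * C := by
    intro m x
    have h1 : fderiv ℝ (κ m) x = ρ m • fderiv ℝ η (ρ m • x) := fderiv_comp_smul _
    rw [h1, norm_smul, Real.norm_of_nonneg (hρ0 m).le]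
    exact mul_le_mul_of_nonneg_left (hC _) (hρ0 m).le
  have hκlim : ∀ x, Tendsto (fun m => κ m x) atTop (𝓝 1) := by
    intro x
    have h1 : Tendsto (fun m => ρ m • x) atTop (𝓝 0) := by simpa using hρ.smul_const x
    have h2 := (hηc.continuous.tendsto 0).comp h1
    have h3 : η 0 = 1 := η.one_of_mem_closedBall (mem_closedBall_self zero_le_one)
    rwa [h3] at h2
  have hprodc : ∀ m, ContDiff ℝ 1 fun x => κ m x * χ x := fun m => (hκc m).mul hχ
  have hprods : ∀ m, HasCompactSupport fun x => κ m x * χ x := fun m => (hκs m).mul_right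
  have hprodi : ∀ m (μ : Measure (Eucl n)) [IsFiniteMeasureOnCompacts μ],
      Integrable (fun x => κ m x * χ x) μ := fun m μ _ =>
    (hprodc m).continuous.integrable_of_hasCompactSupport (hprods m)
  have hineq : ∀ m, (h - δ) * (∫ x in S, κ m x * χ x) - ρ m * C * ∫ x in S, χ x ≤
      (boundaryMeasure S).toReal := by
    intro m
    have h1 := hflux _ (hprodc m) (hprods m) fun x => mul_nonneg (hκ0 m x) (hχ0 x)
    rw [FluxInequality] at h1
    have h2 : ∫ x, κ m x * χ x ∂surfaceMeasure S ≤ (boundaryMeasure S).toReal := by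
      calc ∫ x, κ m x * χ x ∂surfaceMeasure S ≤ ∫ _, (1 : ℝ) ∂surfaceMeasure S :=
            integral_mono (hprodi m _) (integrable_const _) fun x =>
              mul_le_one₀ (hκ1 m x) (hχ0 x) (hχ1 x)
        _ = _ := by simp [Measure.real, surfaceMeasure_univ]
    have hbound : ∀ᵐ x ∂(volume.restrict S), |fderiv ℝ (fun y => κ m y * χ y) x (V x)| ≤
        δ * (κ m x * χ x) + ρ m * C * χ x := by
      filter_upwards [hV1] with x hx
      have h3 : fderiv ℝ (fun y => κ m y * χ y) x =
          κ m x • fderiv ℝ χ x + χ x • fderiv ℝ (κ m) x :=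
        fderiv_fun_mul ((hκc m).differentiable one_ne_zero x) (hχ.differentiable one_ne_zero x)
      have h4 : ‖fderiv ℝ (fun y => κ m y * χ y) x‖ ≤ κ m x * (δ * χ x) + χ x * (ρ m * C) := by
        rw [h3]
        refine (norm_add_le _ _).trans ?_
        rw [norm_smul, norm_smul, Real.norm_of_nonneg (hκ0 m x), Real.norm_of_nonneg (hχ0 x)]
        exact add_le_add (mul_le_mul_of_nonneg_left (hχd x) (hκ0 m x))
          (mul_le_mul_of_nonneg_left (hκd m x) (hχ0 x))
      rw [← Real.norm_eq_abs]
      refine ((fderiv ℝ _ x).le_opNorm _).trans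
        ((mul_le_of_le_one_right (norm_nonneg _) hx).trans (h4.trans (le_of_eq ?_)))
      ring
    have hbi : IntegrableOn (fun x => δ * (κ m x * χ x) + ρ m * C * χ x) S :=
      ((hprodi m _).const_mul _).add (hχi.integrableOn.const_mul _)
    have h5 : -(∫ x in S, (δ * (κ m x * χ x) + ρ m * C * χ x)) ≤
        ∫ x in S, fderiv ℝ (fun y => κ m y * χ y) x (V x) := by
      rw [← integral_neg]
      refine integral_mono_ae hbi.neg (hbi.mono' ?_ hbound) ?_
      · exact isBoundedBilinearMap_apply.continuous.comp_aestronglyMeasurable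
          (((hprodc m).continuous_fderiv one_ne_zero).aestronglyMeasurable.prodMk hVm)
      · filter_upwards [hbound] with x hx using (abs_le.1 hx).1
    rw [integral_add ((hprodi m _).const_mul _) (hχi.integrableOn.const_mul _),
      integral_const_mul, integral_const_mul] at h5
    linarith
  have hlim1 : Tendsto (fun m => ∫ x in S, κ m x * χ x) atTop (𝓝 (∫ x in S, χ x)) := by
    refine tendsto_integral_of_dominated_convergence χ
      (fun m => (hprodc m).continuous.aestronglyMeasurable) hχi.integrableOn
      (fun m => Eventually.of_forall fun x => ?_) (Eventually.of_forall fun x => ?_)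
    · rw [Real.norm_of_nonneg (mul_nonneg (hκ0 m x) (hχ0 x))]
      exact mul_le_of_le_one_left (hχ0 x) (hκ1 m x)
    · simpa using (hκlim x).mul_const (χ x)
  have hlim := (hlim1.const_mul (h - δ)).sub ((hρ.mul_const C).mul_const (∫ x in S, χ x))
  rw [zero_mul, zero_mul, sub_zero] at hlim
  exact le_of_tendsto' hlim hineq

/-- The weight `(1 + ‖ε x‖²) ^ (-n)`: for `n ≥ 1` and `ε > 0` it is integrable on `ℝⁿ`, its
logarithmic gradient is at most `n ε`, and it tends to `1` as `ε → 0`. -/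
noncomputable def weight (n : ℕ) (ε : ℝ) (x : Eucl n) : ℝ := (1 + ‖ε • x‖ ^ 2) ^ (-(n : ℝ))

theorem contDiff_weight (ε : ℝ) : ContDiff ℝ 1 (weight n ε) := by
  refine ContDiff.rpow_const_of_ne (contDiff_const.add ((contDiff_const_smul ε).norm_sq ℝ))
    fun x => ?_
  positivity

theorem weight_pos (ε : ℝ) (x : Eucl n) : 0 < weight n ε x :=
  Real.rpow_pos_of_pos (by positivity) _

theorem weight_le_one (ε : ℝ) (x : Eucl n) : weight n ε x ≤ 1 :=
  Real.rpow_le_one_of_one_le_of_nonpos (by nlinarith [sq_nonneg ‖ε • x‖]) (by simp)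

theorem integrable_weight (hn : 1 ≤ n) {ε : ℝ} (hε : ε ≠ 0) : Integrable (weight n ε) := by
  have h1 : Integrable fun x : Eucl n => ((1 : ℝ) + ‖x‖ ^ 2) ^ (-(2 * (n : ℝ)) / 2) := by
    refine integrable_rpow_neg_one_add_norm_sq ?_
    have : (1 : ℝ) ≤ n := by exact_mod_cast hn
    rw [finrank_euclideanSpace, Fintype.card_fin]
    linarith
  have h2 := h1.comp_smul hε
  refine h2.congr (Eventually.of_forall fun x => ?_)
  simp only [weight]
  congr 1
  ring

theorem norm_fderiv_weight_le {ε : ℝ} (hε : 0 ≤ ε) (x : Eucl n) :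
    ‖fderiv ℝ (weight n ε) x‖ ≤ n * ε * weight n ε x := by
  have hq : 0 < 1 + ‖ε • x‖ ^ 2 := by positivity
  have h1 : HasFDerivAt (fun y : Eucl n => 1 + ‖ε • y‖ ^ 2)
      ((2 * ε ^ 2) • innerSL ℝ x) x := by
    have h2 : (fun y : Eucl n => 1 + ‖ε • y‖ ^ 2) = fun y => 1 + ε ^ 2 * ‖y‖ ^ 2 := by
      funext y
      rw [norm_smul, mul_pow, Real.norm_eq_abs, sq_abs]
    rw [h2]
    have h3 := ((hasStrictFDerivAt_norm_sq x).hasFDerivAt.const_mul (ε ^ 2)).const_add 1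
    convert! h3 using 1
    rw [mul_comm, mul_smul]
    congr 1
    ext y
    simp [two_smul]
  have h4 := (h1.rpow_const (p := -(n : ℝ)) (Or.inl hq.ne')).fderiv
  have h5 : fderiv ℝ (weight n ε) x = _ := h4
  rw [h5, norm_smul, norm_smul (2 * ε ^ 2), innerSL_apply_norm, Real.rpow_sub_one hq.ne',
    norm_mul, norm_neg,
    Real.norm_of_nonneg (Nat.cast_nonneg n), Real.norm_of_nonneg (by positivity : 0 ≤ 2 * ε ^ 2),
    Real.norm_of_nonneg (by positivity)]
  -- `2 s ≤ 1 + s ^ 2` with `s = ε ‖x‖`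
  have h6 : 2 * ε ^ 2 * ‖x‖ ≤ ε * (1 + ‖ε • x‖ ^ 2) := by
    rw [norm_smul, Real.norm_of_nonneg hε]
    nlinarith [mul_nonneg hε (sq_nonneg (1 - ε * ‖x‖))]
  calc n * ((1 + ‖ε • x‖ ^ 2) ^ (-(n : ℝ)) / (1 + ‖ε • x‖ ^ 2)) * (2 * ε ^ 2 * ‖x‖)
      ≤ n * ((1 + ‖ε • x‖ ^ 2) ^ (-(n : ℝ)) / (1 + ‖ε • x‖ ^ 2)) * (ε * (1 + ‖ε • x‖ ^ 2)) := by
        gcongr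
    _ = n * ε * weight n ε x := by
        rw [weight]
        field_simp

/-- The volume of `S` may be infinite here. The integrals of the weights are bounded uniformly in
`ε`, and Fatou's lemma lets `ε → 0`. -/
theorem ofReal_mul_volume_le {V : Eucl n → Eucl n} {h : ℝ} {S : Set (Eucl n)} (hn : 1 ≤ n)
    (hV1 : ∀ᵐ x ∂(volume.restrict S), ‖V x‖ ≤ 1) (hVm : AEStronglyMeasurable V (volume.restrict S))
    (hfin : boundaryMeasure S ≠ ⊤)
    (hflux : ∀ χ : Eucl n → ℝ, ContDiff ℝ 1 χ → HasCompactSupport χ → (∀ x, 0 ≤ χ x) →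
      FluxInequality V h S χ) :
    ENNReal.ofReal h * volume S ≤ boundaryMeasure S := by
  let ρ : ℕ → ℝ := fun m => 1 / ((m : ℝ) + 1)
  have hρ0 : ∀ m, 0 < ρ m := fun m => Nat.one_div_pos_of_nat
  have hρ : Tendsto ρ atTop (𝓝 0) := tendsto_one_div_add_atTop_nhds_zero_nat
  let f : ℕ → Eucl n → ℝ := fun m x => (h - n * ρ m) * weight n (ρ m) x
  have hfc : ∀ m, Continuous (f m) := fun m => continuous_const.mul (contDiff_weight _).continuous
  have hle : ∀ m, ∫⁻ x in S, ENNReal.ofReal (f m x) ≤ boundaryMeasure S := by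
    intro m
    rcases le_total (h - n * ρ m) 0 with h0 | h0
    · have : ∀ x, ENNReal.ofReal (f m x) = 0 := fun x =>
        ENNReal.ofReal_of_nonpos (mul_nonpos_of_nonpos_of_nonneg h0 (weight_pos _ _).le)
      simp [this]
    · have hw := integrable_weight hn (hρ0 m).ne'
      rw [← ofReal_integral_eq_lintegral_ofReal (hw.integrableOn.const_mul _)
        (Eventually.of_forall fun x => mul_nonneg h0 (weight_pos _ _).le), integral_const_mul]
      refine ENNReal.ofReal_le_of_le_toReal ?_
      exact sub_mul_setIntegral_le_of_norm_fderiv_le hV1 hVm hfin hflux (contDiff_weight _) hw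
        (fun x => (weight_pos _ _).le) (weight_le_one _) (norm_fderiv_weight_le (hρ0 m).le)
  have hlim : ∀ x, Tendsto (fun m => ENNReal.ofReal (f m x)) atTop (𝓝 (ENNReal.ofReal h)) := by
    intro x
    refine ENNReal.tendsto_ofReal ?_
    have h1 : Tendsto (fun m => ρ m • x) atTop (𝓝 0) := by simpa using hρ.smul_const x
    have h2 : Tendsto (fun m => 1 + ‖ρ m • x‖ ^ 2) atTop (𝓝 1) := by
      simpa using (h1.norm.pow 2).const_add 1
    have h3 : Tendsto (fun m => weight n (ρ m) x) atTop (𝓝 1) := by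
      have h4 := h2.rpow_const (p := -(n : ℝ)) (Or.inl one_ne_zero)
      rwa [Real.one_rpow] at h4
    simpa using ((hρ.const_mul (n : ℝ)).const_sub h).mul h3
  calc ENNReal.ofReal h * volume S = ∫⁻ x in S, liminf (fun m => ENNReal.ofReal (f m x)) atTop := by
        simp only [fun x => (hlim x).liminf_eq, setLIntegral_const]
    _ ≤ liminf (fun m => ∫⁻ x in S, ENNReal.ofReal (f m x)) atTop :=
        lintegral_liminf_le fun m => (hfc m).measurable.ennreal_ofReal
    _ ≤ liminf (fun _ : ℕ => boundaryMeasure S) atTop :=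
        liminf_le_liminf (Eventually.of_forall hle)
    _ = boundaryMeasure S := liminf_const _

/-! ### Lower bounds for the Cheeger constant -/

theorem le_cheegerConstant (hn : 1 ≤ n) {Ω : Opens (Eucl n)} {V : Eucl n → Eucl n} {h : ℝ}
    (hVm : AEStronglyMeasurable V (volume.restrict (Ω : Set (Eucl n))))
    (hV1 : ∀ᵐ x ∂(volume.restrict (Ω : Set (Eucl n))), ‖V x‖ ≤ 1) (hdiv : DistribDivGE Ω V h) :
    (h : EReal) ≤ (cheegerConstant (Ω : Set (Eucl n)) : EReal) := by
  have key : ENNReal.ofReal h ≤ cheegerConstant (Ω : Set (Eucl n)) := by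
    refine le_iInf₂ fun S hS => ?_
    obtain ⟨U, hUo, hU, hSU, hUΩ⟩ := hS.exists_lipschitz
    rw [ENNReal.le_div_iff_mul_le (Or.inl (hS.isOpen.measure_pos volume hS.nonempty).ne')
      hS.quotient_defined]
    by_cases hfin : boundaryMeasure S = ⊤
    · rw [hfin]; exact le_top
    · exact ofReal_mul_volume_le hn
        (ae_mono (Measure.restrict_mono (hSU.trans hUΩ) le_rfl) hV1)
        (hVm.mono_set (hSU.trans hUΩ)) hfin fun χ hχ hχc hχ0 =>
          fluxInequality_of_hasCompactSupport hVm hV1 hdiv hS.isOpen.measurableSet hUo hU hSU hUΩ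
            hfin hχ hχc hχ0
  calc (h : EReal) ≤ ((max h 0 : ℝ) : EReal) := EReal.coe_le_coe_iff.2 (le_max_left _ _)
    _ = ((ENNReal.ofReal h : ℝ≥0∞) : EReal) := (EReal.coe_ennreal_ofReal).symm
    _ ≤ _ := EReal.coe_ennreal_le_coe_ennreal_iff.2 key

theorem distribDivGE_of_contDiffOn {Ω : Opens (Eucl n)} {V : Eucl n → Eucl n} {h : ℝ}
    (hV : ContDiffOn ℝ ∞ V (Ω : Set (Eucl n))) (hV1 : ∀ x ∈ Ω, ‖V x‖ ≤ 1)
    (hdiv : ∀ x ∈ Ω, h ≤ divergence V x) : DistribDivGE Ω V h := by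
  intro φ hφ0
  have hΩm : MeasurableSet (Ω : Set (Eucl n)) := Ω.isOpen.measurableSet
  have hφ : ContDiff ℝ 1 φ := φ.contDiff.of_le (by norm_cast)
  have hVat : ∀ x ∈ Ω, ContDiffAt ℝ 1 V x := fun x hx =>
    (hV.contDiffAt (Ω.isOpen.mem_nhds hx)).of_le (by norm_cast)
  have hX : ContDiff ℝ 1 fun x => φ x • V x := by
    rw [contDiff_iff_contDiffAt]
    intro x
    by_cases hx : x ∈ tsupport φ
    · exact hφ.contDiffAt.smul (hVat x (φ.tsupport_subset hx))
    · have h0 : (fun x => φ x • V x) =ᶠ[𝓝 x] fun _ => 0 := by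
        filter_upwards [(isClosed_tsupport φ).isOpen_compl.mem_nhds hx] with y hy
        rw [image_eq_zero_of_notMem_tsupport hy, zero_smul]
      exact contDiffAt_const.congr_of_eventuallyEq h0
  have hXs : HasCompactSupport fun x => φ x • V x := φ.hasCompactSupport.smul_right
  have hdivX : Continuous (divergence fun x => φ x • V x) := continuous_divergence hX
  have hzero : ∫ x in (Ω : Set (Eucl n)), divergence (fun x => φ x • V x) x ≤ 0 := by
    -- the whole space has empty boundary
    have h1 := setIntegral_divergence_le (S := univ) MeasurableSet.univ
      (by simp [boundaryMeasure]) hX hXs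
    rw [setIntegral_eq_integral_of_forall_compl_eq_zero]
    · simpa [surfaceMeasure] using h1
    · intro x hx
      have h2 : x ∉ tsupport fun x => φ x • V x := fun hx' =>
        hx (φ.tsupport_subset (closure_mono (Function.support_smul_subset_left φ V) hx'))
      simp [divergence, fderiv_of_notMem_tsupport ℝ h2]
  have hφi : IntegrableOn φ (Ω : Set (Eucl n)) :=
    (φ.continuous.integrable_of_hasCompactSupport φ.hasCompactSupport).integrableOn
  have hD : Continuous (fderiv ℝ φ) := hφ.continuous_fderiv one_ne_zero
  have hDi : IntegrableOn (fun x => fderiv ℝ φ x (V x)) (Ω : Set (Eucl n)) := by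
    refine Integrable.mono' (g := fun x => ‖fderiv ℝ φ x‖)
      (hD.integrable_of_hasCompactSupport (φ.hasCompactSupport.fderiv ℝ)).norm.integrableOn ?_ ?_
    · exact isBoundedBilinearMap_apply.continuous.comp_aestronglyMeasurable
        (hD.aestronglyMeasurable.prodMk (hV.continuousOn.aestronglyMeasurable hΩm))
    · refine ae_restrict_of_forall_mem hΩm fun x hx => ?_
      exact ((fderiv ℝ φ x).le_opNorm _).trans
        (mul_le_of_le_one_right (norm_nonneg _) (hV1 x hx))
  have hmono : ∫ x in (Ω : Set (Eucl n)), (h * φ x + fderiv ℝ φ x (V x)) ≤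
      ∫ x in (Ω : Set (Eucl n)), divergence (fun x => φ x • V x) x := by
    refine setIntegral_mono_on ((hφi.const_mul h).add hDi)
      (hdivX.integrable_of_hasCompactSupport (hasCompactSupport_divergence hXs)).integrableOn
      hΩm fun x hx => ?_
    rw [divergence_smul (hφ.differentiable one_ne_zero x)
      ((hVat x hx).differentiableAt one_ne_zero)]
    have := mul_le_mul_of_nonneg_left (hdiv x hx) (hφ0 x)
    linarith
  rw [integral_add (hφi.const_mul h) hDi, integral_const_mul] at hmono
  simp only [distribDiv, sum_mul_apply_unitVec]
  linarith

end CheegerField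

theorem proposition1 (n : ℕ) (hn : 1 ≤ n)
    (Ω : TopologicalSpace.Opens (CheegerField.Eucl n)) (h : ℝ) :
    (∀ V : CheegerField.Eucl n → CheegerField.Eucl n,
      ContDiffOn ℝ ((⊤ : ℕ∞) : WithTop ℕ∞) V (Ω : Set (CheegerField.Eucl n)) →
      (∀ x ∈ Ω, ‖V x‖ ≤ 1) →
      (∀ x ∈ Ω, h ≤ CheegerField.divergence V x) →
      (h : EReal) ≤
        (CheegerField.cheegerConstant (Ω : Set (CheegerField.Eucl n)) : EReal)) ∧
    (∀ V : CheegerField.Eucl n → CheegerField.Eucl n,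
      (CheegerField.MemXDiv Ω V ∨ CheegerField.MemXBV Ω V) →
      (∀ᵐ x ∂(MeasureTheory.volume.restrict (Ω : Set (CheegerField.Eucl n))), ‖V x‖ ≤ 1) →
      CheegerField.DistribDivGE Ω V h →
      (h : EReal) ≤
        (CheegerField.cheegerConstant (Ω : Set (CheegerField.Eucl n)) : EReal)) := by
  refine ⟨fun V hV hV1 hdiv => ?_, fun V hV hV1 hdiv => ?_⟩
  · exact CheegerField.le_cheegerConstant hn
      (hV.continuousOn.aestronglyMeasurable Ω.isOpen.measurableSet)
      (ae_restrict_of_forall_mem Ω.isOpen.measurableSet hV1)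
      (CheegerField.distribDivGE_of_contDiffOn hV hV1 hdiv)
  · exact CheegerField.le_cheegerConstant hn
      (hV.elim (fun hX => hX.memLp.aestronglyMeasurable) fun hX => hX.memLp.aestronglyMeasurable)
      hV1 hdiv
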